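/- Let $K$ be a field, let $E=K\langle e_1,\dots,e_n\rangle$ be the exterior algebra over $K$ with $\deg e_i=1$, and let $\mathcal M$ be the category of finitely generated $\mathbb Z$-graded left and right $E$-modules $M$ with $am=(-1)^{\deg a\,\deg m}ma$ for homogeneous $a\in E$, $m\in M$. For $M\in\mathcal M$ let $M^*=\operatorname{Hom}_E(M,E)\in\mathcal M$. An element $v\in E_1$ is called $M$-regular if $0:_M v=vM$. A sequence $v_1,\dots,v_s\in E_1$ is an $M$-regular sequence if $v_i$ is $M/(v_1,\dots,v_{i-1})M$-regular for $i=1,\dots,s$ and $M/(v_1,\dots,v_s)M\neq 0$. The depth of $M\ne 0$, denoted $\operatorname{depth} M$, is the maximal length of an $M$-regular sequence. The complexity of $M$ is $$\operatorname{cx} M=\inf\{c\in\mathbb N : \text{there is } \alpha\in\mathbb R \text{ with } \beta_i(M)\le \alpha\, i^{c-1}\text{ for all } i\ge 1\},$$ where $\beta_i(M)=\dim_K\operatorname{Tor}_i^E(K,M)$. Theorem. Let $0\ne M\in\mathcal M$. A sequence $v_1,\dots,v_s\in E_1$ is an $M$-regular sequence if and only if it is an $M^*$-regular sequence. Moreover,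 $$\operatorname{depth} M=\operatorname{depth} M^*\quad\text{and}\quad \operatorname{cx} M=\operatorname{cx} M^*.$$ -/

import Mathlib

open scoped DirectSum

universe u

namespace ExtAlg

/-- The exterior algebra `E = K⟨e₁, …, eₙ⟩` over the vector space with basis `e₁, …, eₙ`. -/
abbrev E (K : Type u) [Field K] (n : ℕ) : Type u := ExteriorAlgebra K (Fin n → K)

/-- The degree `k` part `E_k` of `E`, for an integer `k`; it is `0` for `k < 0`. -/
def degPart (K : Type u) [Field K] (n : ℕ) : ℤ → Submodule K (E K n)
  | .ofNat i => ⋀[K]^i (Fin n → K)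
  | .negSucc _ => ⊥

/-- An object of the category `𝓜`: a finitely generated `ℤ`-graded left and right `E`-module `M`
(the two actions commute) with `a m = (-1)^(deg a * deg m) m a` for homogeneous `a ∈ E`, `m ∈ M`.
The right action is written as an action of the opposite algebra: `MulOpposite.op a • m` is `m a`.
(That the right action is graded as well is a consequence.) -/
structure GrMod (K : Type u) [Field K] (n : ℕ) where
  carrier : Type u
  [addCommGroup : AddCommGroup carrier]
  [leftModule : Module (E K n) carrier]
  [rightModule : Module (E K n)ᵐᵒᵖ carrier]
  [bimodule : SMulCommClass (E K n) (E K n)ᵐᵒᵖ carrier]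
  [finite : Module.Finite (E K n) carrier]
  piece : ℤ → AddSubgroup carrier
  internal : DirectSum.IsInternal piece
  smul_mem : ∀ (i : ℕ) (j : ℤ) (a : E K n) (m : carrier),
    a ∈ ⋀[K]^i (Fin n → K) → m ∈ piece j → a • m ∈ piece (i + j)
  smul_eq : ∀ (i : ℕ) (j : ℤ) (a : E K n) (m : carrier),
    a ∈ ⋀[K]^i (Fin n → K) → m ∈ piece j →
      a • m = ((i : ℤ) * j).negOnePow • (MulOpposite.op a • m)

attribute [instance] GrMod.addCommGroup GrMod.leftModule GrMod.rightModule GrMod.bimodule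
  GrMod.finite

section Dual

variable {K : Type u} [Field K] {n : ℕ}

/-- The left action of `E` on the left `E`-linear maps `M → E`: `(a f)(m) = f(m a)`. The right
action is the one of Mathlib, `(f a)(m) = f(m) a`. -/
@[reducible]
def homLeftModule (M : Type u) [AddCommGroup M] [Module (E K n) M] [Module (E K n)ᵐᵒᵖ M]
    [SMulCommClass (E K n) (E K n)ᵐᵒᵖ M] : Module (E K n) (M →ₗ[E K n] E K n) where
  smul a f :=
    { toFun := fun m => f (MulOpposite.op a • m)
      map_add' := fun x y => by rw [smul_add, map_add]
      map_smul' := fun b x => by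
        rw [← smul_comm b (MulOpposite.op a) x, map_smul, RingHom.id_apply] }
  one_smul f := by
    ext m
    change f (MulOpposite.op (1 : E K n) • m) = f m
    rw [MulOpposite.op_one, one_smul]
  mul_smul a b f := by
    ext m
    change f (MulOpposite.op (a * b) • m) = f (MulOpposite.op b • MulOpposite.op a • m)
    rw [MulOpposite.op_mul, mul_smul]
  smul_zero a := rfl
  smul_add a f g := rfl
  add_smul a b f := by
    ext m
    change f (MulOpposite.op (a + b) • m) = f (MulOpposite.op a • m) + f (MulOpposite.op b • m)
    rw [MulOpposite.op_add, add_smul, map_add]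
  zero_smul f := by
    ext m
    change f (MulOpposite.op (0 : E K n) • m) = 0
    rw [MulOpposite.op_zero, zero_smul, map_zero]

/-- The homomorphisms `M → E` of degree `j`: those that map `M_i` to `E_{i+j}` for all `i`. -/
def homPiece (M : GrMod K n) (j : ℤ) : AddSubgroup (M.carrier →ₗ[E K n] E K n) where
  carrier := {f | ∀ (i : ℤ), ∀ m ∈ M.piece i, f m ∈ degPart K n (i + j)}
  add_mem' hf hg i m hm := add_mem (hf i m hm) (hg i m hm)
  zero_mem' _ _ _ := zero_mem _
  neg_mem' hf i m hm := neg_mem (hf i m hm)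

/-! Facts that make `Hom_E(M, E)` an object of the category. -/

theorem mul_mem_degPart (i : ℕ) (k : ℤ) (a x : E K n) (ha : a ∈ ⋀[K]^i (Fin n → K))
    (hx : x ∈ degPart K n k) : a * x ∈ degPart K n (i + k) := by
  obtain k | k := k
  · have : ((i : ℤ) + Int.ofNat k) = Int.ofNat (i + k) := rfl
    rw [this]
    exact SetLike.mul_mem_graded (A := fun i : ℕ => ⋀[K]^i (Fin n → K)) ha hx
  · have hx' : x = 0 := hx
    rw [hx', mul_zero]
    exact zero_mem _

theorem comm_one (k : ℕ) (v : Fin n → K) (x : E K n) (hx : x ∈ ⋀[K]^k (Fin n → K)) :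
    x * ExteriorAlgebra.ι K v = (-1) ^ k * (ExteriorAlgebra.ι K v * x) := by
  induction hx using Submodule.pow_induction_on_left' with
  | algebraMap r => simp [Algebra.commutes]
  | add x y i _ _ h1 h2 => rw [add_mul, h1, h2]; noncomm_ring
  | mem_mul m hm i x _ h =>
    obtain ⟨w, rfl⟩ := hm
    have h1 := ExteriorAlgebra.ι_add_mul_swap (R := K) w v
    have h2 : ExteriorAlgebra.ι K w * ExteriorAlgebra.ι K v =
      - (ExteriorAlgebra.ι K v * ExteriorAlgebra.ι K w) := eq_neg_of_add_eq_zero_left h1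
    have hc : ∀ y : E K n, y * (-1) ^ i = (-1) ^ i * y := fun y =>
      ((Commute.one_right y).neg_right.pow_right i).eq
    rw [mul_assoc, h, ← mul_assoc, hc, mul_assoc, ← mul_assoc (ExteriorAlgebra.ι K w), h2, pow_succ]
    noncomm_ring

theorem comm_nat (d k : ℕ) (a x : E K n) (ha : a ∈ ⋀[K]^d (Fin n → K))
    (hx : x ∈ ⋀[K]^k (Fin n → K)) : a * x = (-1) ^ (d * k) * (x * a) := by
  induction ha using Submodule.pow_induction_on_left' with
  | algebraMap r => simp [Algebra.commutes]
  | add a b i _ _ h1 h2 => rw [add_mul, h1, h2]; noncomm_ring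
  | mem_mul m hm i a _ h =>
    obtain ⟨w, rfl⟩ := hm
    have hc : ∀ (j : ℕ) (y : E K n), y * (-1) ^ j = (-1) ^ j * y := fun j y =>
      ((Commute.one_right y).neg_right.pow_right j).eq
    have h2 : ExteriorAlgebra.ι K w * x = (-1) ^ k * (x * ExteriorAlgebra.ι K w) := by
      rw [comm_one k w x hx, ← mul_assoc, ← pow_add, Even.neg_one_pow ⟨k, rfl⟩, one_mul]
    rw [mul_assoc, h, ← mul_assoc, hc, mul_assoc, ← mul_assoc (ExteriorAlgebra.ι K w), h2,
      Nat.succ_mul, pow_add]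
    simp only [mul_assoc]

theorem comm_int (d : ℕ) (k : ℤ) (a x : E K n) (ha : a ∈ ⋀[K]^d (Fin n → K))
    (hx : x ∈ degPart K n k) : a * x = ((d : ℤ) * k).negOnePow • (x * a) := by
  obtain k | k := k
  · rw [comm_nat d k a x ha hx]
    have : ((d : ℤ) * Int.ofNat k) = ((d * k : ℕ) : ℤ) := by simp
    rw [this, Int.negOnePow_def, zpow_natCast, Units.smul_def, zsmul_eq_mul]
    simp
  · have hx' : x = 0 := hx
    simp [hx']

/-- The projection of `E` onto its degree `k` part. -/
noncomputable def degProj (k : ℤ) : E K n →+ E K n :=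
  match k with
  | .ofNat i => (GradedRing.proj (fun i : ℕ => ⋀[K]^i (Fin n → K)) i)
  | .negSucc _ => 0

theorem degProj_mem (k : ℤ) (x : E K n) : degProj k x ∈ degPart K n k := by
  obtain k | k := k
  · exact SetLike.coe_mem _
  · exact zero_mem _

theorem degProj_same (k : ℤ) (x : E K n) (hx : x ∈ degPart K n k) : degProj k x = x := by
  obtain k | k := k
  · exact DirectSum.decompose_of_mem_same (fun i : ℕ => ⋀[K]^i (Fin n → K)) hx
  · exact (show x = 0 from hx).symm

theorem degProj_ne (k l : ℤ) (h : k ≠ l) (x : E K n) (hx : x ∈ degPart K n k) :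
    degProj l x = 0 := by
  obtain k | k := k
  · obtain l | l := l
    · exact DirectSum.decompose_of_mem_ne (fun i : ℕ => ⋀[K]^i (Fin n → K)) hx
        (fun e => h (by rw [e]))
    · rfl
  · rw [show x = 0 from hx, map_zero]

theorem degProj_sum (x : E K n) :
    ∃ S : Finset ℤ, ∀ T, S ⊆ T → ∑ k ∈ T, degProj k x = x := by
  induction x using DirectSum.Decomposition.inductionOn (fun i : ℕ => ⋀[K]^i (Fin n → K)) with
  | zero => exact ⟨∅, fun T _ => by simp⟩
  | @homogeneous i x =>
    have hx : (x : E K n) ∈ degPart K n (Int.ofNat i) := x.2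
    refine ⟨{Int.ofNat i}, fun T hT => ?_⟩
    rw [Finset.sum_eq_single_of_mem (Int.ofNat i) (hT (by simp))
      (fun b _ hb => degProj_ne _ _ hb.symm _ hx), degProj_same _ _ hx]
  | add x y hx hy =>
    obtain ⟨S, hS⟩ := hx
    obtain ⟨S', hS'⟩ := hy
    refine ⟨S ∪ S', fun T hT => ?_⟩
    simp only [map_add, Finset.sum_add_distrib]
    rw [hS T (Finset.union_subset_left hT), hS' T (Finset.union_subset_right hT)]

theorem degProj_mul (i : ℕ) (k : ℤ) (a x : E K n) (ha : a ∈ ⋀[K]^i (Fin n → K)) :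
    degProj (i + k) (a * x) = a * degProj k x := by
  obtain ⟨S, hS⟩ := degProj_sum x
  conv_lhs => rw [← hS (insert k S) (Finset.subset_insert _ _)]
  rw [Finset.mul_sum, map_sum, Finset.sum_eq_single_of_mem k (Finset.mem_insert_self _ _)]
  · exact degProj_same _ _ (mul_mem_degPart _ _ _ _ ha (degProj_mem _ _))
  · intro b _ hb
    exact degProj_ne (i + b) _ (by omega) _ (mul_mem_degPart _ _ _ _ ha (degProj_mem _ _))

theorem isInternal_of_proj {A : Type u} [AddCommGroup A] (P : ℤ → AddSubgroup A)
    (π : ℤ → A → A) (π_add : ∀ k x y, π k (x + y) = π k x + π k y)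
    (mem : ∀ k x, π k x ∈ P k) (same : ∀ k, ∀ x ∈ P k, π k x = x)
    (ne : ∀ k l, k ≠ l → ∀ x ∈ P k, π l x = 0)
    (sum : ∀ x, ∃ S : Finset ℤ, ∑ k ∈ S, π k x = x) : DirectSum.IsInternal P := by
  have key : ∀ (x : ⨁ i, P i) (k : ℤ), π k (DirectSum.coeAddMonoidHom P x) = x k := by
    intro x k
    induction x using DirectSum.induction_on with
    | zero =>
      rw [map_zero, ne (k + 1) k (by omega) 0 (zero_mem _)]
      rfl
    | of i x =>
      rw [DirectSum.coeAddMonoidHom_of]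
      by_cases h : i = k
      · subst h
        rw [same _ _ x.2, DirectSum.of_eq_same]
      · rw [ne _ _ h _ x.2, DirectSum.of_eq_of_ne _ _ _ (Ne.symm h)]
        rfl
    | add x y hx hy =>
      rw [map_add, π_add, hx, hy]
      rfl
  refine ⟨?_, ?_⟩
  · intro x y hxy
    ext k
    rw [← key, ← key, hxy]
  · intro x
    obtain ⟨S, hS⟩ := sum x
    refine ⟨∑ k ∈ S, DirectSum.of (fun k => P k) k ⟨π k x, mem k x⟩, ?_⟩
    rw [map_sum]
    conv_rhs => rw [← hS]
    exact Finset.sum_congr rfl fun k _ => DirectSum.coeAddMonoidHom_of P k ⟨π k x, mem k x⟩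

theorem piece_induction (M : GrMod K n) {p : M.carrier → Prop} (h0 : p 0)
    (hom : ∀ i, ∀ m ∈ M.piece i, p m) (add : ∀ x y, p x → p y → p (x + y)) (m : M.carrier) :
    p m := by
  obtain ⟨x, rfl⟩ := M.internal.2 m
  induction x using DirectSum.induction_on with
  | zero => rwa [map_zero]
  | of i x => rw [DirectSum.coeAddMonoidHom_of]; exact hom i _ x.2
  | add x y hx hy => rw [map_add]; exact add _ _ hx hy

/-- The additive map underlying the degree `j` component of `f`. -/
noncomputable def homProjAux (M : GrMod K n) (j : ℤ) (f : M.carrier →ₗ[E K n] E K n) :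
    M.carrier →+ E K n :=
  (DirectSum.toAddMonoid fun i : ℤ =>
    ((degProj (i + j)).comp f.toAddMonoidHom).comp (M.piece i).subtype).comp
    (AddEquiv.ofBijective _ M.internal).symm.toAddMonoidHom

theorem homProjAux_apply (M : GrMod K n) (j : ℤ) (f : M.carrier →ₗ[E K n] E K n) (i : ℤ)
    (m : M.carrier) (hm : m ∈ M.piece i) : homProjAux M j f m = degProj (i + j) (f m) := by
  have : (AddEquiv.ofBijective _ M.internal).symm m =
      DirectSum.of (fun i => M.piece i) i ⟨m, hm⟩ := by
    rw [AddEquiv.symm_apply_eq]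
    exact (DirectSum.coeAddMonoidHom_of M.piece i ⟨m, hm⟩).symm
  change DirectSum.toAddMonoid _ ((AddEquiv.ofBijective _ M.internal).symm m) = _
  rw [this, DirectSum.toAddMonoid_of]
  rfl

/-- The degree `j` component of `f`. -/
noncomputable def homProj (M : GrMod K n) (j : ℤ) (f : M.carrier →ₗ[E K n] E K n) :
    M.carrier →ₗ[E K n] E K n :=
  { homProjAux M j f with
    map_smul' := fun a m => by
      change homProjAux M j f (a • m) = a • homProjAux M j f m
      induction a using DirectSum.Decomposition.inductionOn
        (fun i : ℕ => ⋀[K]^i (Fin n → K)) with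
      | zero => simp
      | @homogeneous d a =>
        induction m using piece_induction M with
        | h0 => simp
        | hom i m hm =>
          rw [homProjAux_apply M j f _ _ (M.smul_mem d i a m a.2 hm), homProjAux_apply M j f _ _ hm,
            map_smul, smul_eq_mul, smul_eq_mul, add_assoc, degProj_mul _ _ _ _ a.2]
        | add x y hx hy => rw [smul_add, map_add, map_add, hx, hy, smul_add]
      | add a b ha hb => rw [add_smul, map_add, ha, hb, add_smul] }

theorem homProj_apply (M : GrMod K n) (j : ℤ) (f : M.carrier →ₗ[E K n] E K n) (i : ℤ)
    (m : M.carrier) (hm : m ∈ M.piece i) : homProj M j f m = degProj (i + j) (f m) :=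
  homProjAux_apply M j f i m hm

theorem hom_ext (M : GrMod K n) {f g : M.carrier →ₗ[E K n] E K n}
    (h : ∀ i, ∀ m ∈ M.piece i, f m = g m) : f = g := by
  ext m
  induction m using piece_induction M with
  | h0 => simp
  | hom i m hm => exact h i m hm
  | add x y hx hy => rw [map_add, map_add, hx, hy]

theorem homProj_sum (M : GrMod K n) (f : M.carrier →ₗ[E K n] E K n) :
    ∃ S : Finset ℤ, ∑ j ∈ S, homProj M j f = f := by
  classical
  have loc : ∀ m : M.carrier, ∃ S : Finset ℤ, ∀ T, S ⊆ T → ∑ j ∈ T, homProj M j f m = f m := by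
    intro m
    induction m using piece_induction M with
    | h0 => exact ⟨∅, fun T _ => by simp⟩
    | hom i m hm =>
      obtain ⟨S, hS⟩ := degProj_sum (f m)
      refine ⟨S.image fun k => k - i, fun T hT => ?_⟩
      rw [Finset.sum_congr rfl fun j _ => homProj_apply M j f i m hm]
      rw [← Finset.sum_image (f := fun k => degProj k (f m)) (g := fun j => i + j)
        (fun x _ y _ h => add_left_cancel h)]
      refine hS _ fun k hk => ?_
      rw [Finset.mem_image]
      exact ⟨k - i, hT (Finset.mem_image_of_mem _ hk), by ring⟩
    | add x y hx hy =>
      obtain ⟨S, hS⟩ := hx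
      obtain ⟨S', hS'⟩ := hy
      refine ⟨S ∪ S', fun T hT => ?_⟩
      simp only [map_add, Finset.sum_add_distrib]
      rw [hS T (Finset.union_subset_left hT), hS' T (Finset.union_subset_right hT)]
  choose S hS using loc
  obtain ⟨G, hG⟩ := Module.Finite.fg_top (R := E K n) (M := M.carrier)
  refine ⟨G.biUnion S, LinearMap.ext_on hG fun g hg => ?_⟩
  rw [LinearMap.sum_apply]
  exact hS g _ (Finset.subset_biUnion_of_mem S hg)

theorem homPiece_internal (M : GrMod K n) : DirectSum.IsInternal (homPiece M) := by
  refine isInternal_of_proj (homPiece M) (homProj M) ?_ ?_ ?_ ?_ (homProj_sum M)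
  · intro k f g
    refine hom_ext M fun i m hm => ?_
    rw [LinearMap.add_apply]
    simp only [homProj_apply M _ _ i m hm, LinearMap.add_apply, map_add]
  · intro k f i m hm
    rw [homProj_apply M k f i m hm]
    exact degProj_mem _ _
  · intro k f hf
    refine hom_ext M fun i m hm => ?_
    rw [homProj_apply M k f i m hm, degProj_same _ _ (hf i m hm)]
  · intro k l hkl f hf
    refine hom_ext M fun i m hm => ?_
    rw [homProj_apply M l f i m hm, degProj_ne (i + k) _ (by omega) _ (hf i m hm)]
    rfl

theorem smul_eq_smul_of_field (M : GrMod K n) (c : K) (m : M.carrier) :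
    MulOpposite.op (algebraMap K (E K n) c) • m = algebraMap K (E K n) c • m := by
  induction m using piece_induction M with
  | h0 => simp
  | hom i m hm =>
    have h0 : algebraMap K (E K n) c ∈ ⋀[K]^0 (Fin n → K) := by
      rw [ExteriorAlgebra.exteriorPower, pow_zero]
      exact Submodule.algebraMap_mem c
    rw [M.smul_eq 0 i _ m h0 hm]
    simp
  | add x y hx hy => rw [smul_add, smul_add, hx, hy]

theorem finite_E : Module.Finite K (E K n) :=
  Module.Finite.of_basis (Pi.basisFun K (Fin n)).ExteriorAlgebra

theorem hom_finite (M : GrMod K n) :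
    letI := homLeftModule (K := K) (n := n) M.carrier
    Module.Finite (E K n) (M.carrier →ₗ[E K n] E K n) := by
  let _ := homLeftModule (K := K) (n := n) M.carrier
  let _ : Module K M.carrier := Module.compHom _ (algebraMap K (E K n))
  have : IsScalarTower K (E K n) M.carrier := ⟨fun c a m => by
    change (c • a) • m = algebraMap K (E K n) c • a • m
    rw [Algebra.smul_def, mul_smul]⟩
  have : Module.Finite K (E K n) := finite_E
  have : Module.Finite K M.carrier := Module.Finite.trans (E K n) M.carrier
  have : IsScalarTower K (E K n) (M.carrier →ₗ[E K n] E K n) := ⟨fun c a f => by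
    ext m
    change f (MulOpposite.op (c • a) • m) = c • f (MulOpposite.op a • m)
    rw [Algebra.smul_def, Algebra.commutes, MulOpposite.op_mul, mul_smul, smul_eq_smul_of_field,
      map_smul, algebraMap_smul]⟩
  let φ : (M.carrier →ₗ[E K n] E K n) →ₗ[K] (M.carrier →ₗ[K] E K n) :=
    { toFun := fun f => f.restrictScalars K
      map_add' := fun _ _ => rfl
      map_smul' := fun _ _ => rfl }
  have hφ : Function.Injective φ := LinearMap.restrictScalars_injective K
  have : Module.Finite K (M.carrier →ₗ[E K n] E K n) := Module.Finite.of_injective φ hφ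
  exact Module.Finite.of_restrictScalars_finite K (E K n) _

end Dual

/-- The dual `M^* = Hom_E(M, E)` as an object of the category: the left `E`-linear maps `M → E`
with `(a f)(m) = f(m a)` and `(f a)(m) = f(m) a`, graded by the degree of homomorphisms. -/
def GrMod.dual {K : Type u} [Field K] {n : ℕ} (M : GrMod K n) : GrMod K n :=
  letI := homLeftModule (K := K) (n := n) M.carrier
  { carrier := M.carrier →ₗ[E K n] E K n
    bimodule := ⟨fun _ _ _ => rfl⟩
    finite := hom_finite M
    piece := homPiece M
    internal := homPiece_internal M
    smul_mem := fun i j a f ha hf k m hm => by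
      change f (MulOpposite.op a • m) ∈ _
      have h := M.smul_eq i k a m ha hm
      have h' : MulOpposite.op a • m = ((i : ℤ) * k).negOnePow • (a • m) := by
        rw [h, smul_smul, Int.units_mul_self, one_smul]
      have e : k + (i + j) = i + (k + j) := by ring
      rw [h', Units.smul_def, map_zsmul, map_smul, e]
      exact zsmul_mem (mul_mem_degPart _ _ _ _ ha (hf k m hm)) _
    smul_eq := fun i j a f ha hf => by
      refine hom_ext M fun k m hm => ?_
      have h := M.smul_eq i k a m ha hm
      have h' : MulOpposite.op a • m = ((i : ℤ) * k).negOnePow • (a • m) := by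
        rw [h, smul_smul, Int.units_mul_self, one_smul]
      change f (MulOpposite.op a • m) = ((i : ℤ) * j).negOnePow • (f m * a)
      rw [h', Units.smul_def, map_zsmul, map_smul, smul_eq_mul,
        comm_int i (k + j) a (f m) ha (hf k m hm), ← Units.smul_def, smul_smul, mul_add,
        Int.negOnePow_add, ← mul_assoc, Int.units_mul_self, one_mul] }

section Regular

variable {K : Type u} [Field K] {n : ℕ}

/-- `v ∈ E_1` is regular on `N`: the annihilator `0 :_N v` is the submodule `v N`. -/
def IsRegularOn (N : Type*) [AddCommGroup N] [Module (E K n) N] (v : ⋀[K]^1 (Fin n → K)) : Prop :=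
  {x : N | (v : E K n) • x = 0} = {x : N | ∃ y : N, x = (v : E K n) • y}

/-- `v_1, …, v_s ∈ E_1` is an `M`-regular sequence: each `v_i` is regular on
`M / (v_1, …, v_{i-1}) M`, and `M / (v_1, …, v_s) M ≠ 0`. -/
def IsRegularSeq (M : Type*) [AddCommGroup M] [Module (E K n) M] {s : ℕ}
    (v : Fin s → ⋀[K]^1 (Fin n → K)) : Prop :=
  (∀ i : Fin s, IsRegularOn
    (M ⧸ (Ideal.span {a : E K n | ∃ j : Fin s, j < i ∧ a = v j} • (⊤ : Submodule (E K n) M)))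
    (v i)) ∧
  Nontrivial
    (M ⧸ (Ideal.span {a : E K n | ∃ j : Fin s, a = v j} • (⊤ : Submodule (E K n) M)))

/-- The depth of `M` over `E`: the supremum of the lengths of the `M`-regular sequences. -/
noncomputable def depth (K : Type u) [Field K] (n : ℕ) (M : Type*) [AddCommGroup M]
    [Module (E K n) M] : ℕ∞ :=
  ⨆ s ∈ {s : ℕ | ∃ v : Fin s → ⋀[K]^1 (Fin n → K), IsRegularSeq M v}, (s : ℕ∞)

end Regular

section Complexity

open CategoryTheory

variable (K : Type u) [Field K] (n : ℕ)

/-- The ideal `𝔪 = (e_1, …, e_n)` of `E`, the kernel of the augmentation `E → K`. -/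
noncomputable def maxIdeal : Ideal (E K n) :=
  RingHom.ker (ExteriorAlgebra.algebraMapInv : E K n →ₐ[K] K)

/-- The functor `M ↦ (E/𝔪) ⊗_E M = M / 𝔪 M` on left `E`-modules. -/
noncomputable def modMaxIdeal : ModuleCat.{u} (E K n) ⥤ ModuleCat.{u} (E K n) where
  obj M := ModuleCat.of (E K n) (M ⧸ (maxIdeal K n • (⊤ : Submodule (E K n) M)))
  map {M N} f := ModuleCat.ofHom
    ((maxIdeal K n • (⊤ : Submodule (E K n) M)).mapQ (maxIdeal K n • (⊤ : Submodule (E K n) N))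
      f.hom (by
        rw [Submodule.smul_le]
        intro a ha x _
        rw [Submodule.mem_comap, map_smul]
        exact Submodule.smul_mem_smul ha trivial))
  map_id M := by
    ext x
    rfl
  map_comp f g := by
    ext x
    rfl

instance : (modMaxIdeal K n).Additive where
  map_add {M N f g} := by
    ext x
    obtain ⟨x, rfl⟩ := Submodule.Quotient.mk_surjective _ x
    rfl

/-- The functor `K ⊗_E -` from left `E`-modules to `K`-vector spaces, where `K = E/𝔪`. -/
noncomputable def tensorField : ModuleCat.{u} (E K n) ⥤ ModuleCat.{u} K :=
  modMaxIdeal K n ⋙ ModuleCat.restrictScalars (algebraMap K (E K n))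

instance : (tensorField K n).Additive :=
  inferInstanceAs (modMaxIdeal K n ⋙ ModuleCat.restrictScalars (algebraMap K (E K n))).Additive

/-- The `i`-th total Betti number `β_i(M) = dim_K Tor_i^E(K, M)`. -/
noncomputable def betti (M : Type u) [AddCommGroup M] [Module (E K n) M] (i : ℕ) : ℕ :=
  Module.finrank K (((tensorField K n).leftDerived i).obj (ModuleCat.of (E K n) M))

/-- The complexity of `M`: the infimum of the `c ∈ ℕ` for which there is a real `α` with
`β_i(M) ≤ α i^(c-1)` for all `i ≥ 1`. -/
noncomputable def cx (M : Type u) [AddCommGroup M] [Module (E K n) M] : ℕ∞ :=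
  ⨅ c ∈ {c : ℕ | ∃ α : ℝ, ∀ i : ℕ, 1 ≤ i → (betti K n M i : ℝ) ≤ α * (i : ℝ) ^ ((c : ℤ) - 1)},
    (c : ℕ∞)

end Complexity

end ExtAlg

/-!
Three ideas carry the proof. Write `e_1, …, e_n` for the generators of `E`.

*The dual is the vector space dual.* The coefficient at `e_1 ⋯ e_n` is a nondegenerate functional
on `E`. Composing with it, and twisting by the sign `(-1)^(d(d-1)/2)` in degree `d`, identifies
`M^*` with the dual vector space of `M` in such a way that each `v ∈ E_1` acts on `M^*` by the
transpose of its action on `M` (`dualEquiv`, `dualEquiv_smul`).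

*Regular sequences are detected by one self-dual condition.* For anticommuting operators `v_1, …,
v_s` of square zero on a finite-dimensional space, with product `p = v_1 ⋯ v_s`, each `v_i` is
regular modulo the images of the previous ones if and only if `ker p = ∑ im v_j`. This implies
`im p = ⋂ ker v_j`, which is the same condition for the transposes. The quotient by all the images
is then nonzero if and only if `p ≠ 0`, which is self-dual too (`isRegularSeq_dual_iff`).

*Betti numbers come from a matrix of linear forms.* `Tor_i^E(K, M)` is, for `i ≥ 1`, the homology of
the Cartan complex of `M`, whose elements of degree `i` are the functions from the monomials of
degree `i` in `n` variables to `M`, with `(∂f)(α) = ∑_j e_j f(α + δ_j)`: this complex is acyclic for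
projective modules, and both sides shift along the syzygies of a projective resolution
(`betti_succ_eq_cartanDim`). Let `A = ∑_j x_j a_j`, where `a_j` is the matrix of `e_j` in a
homogeneous basis of `M`; it is a square matrix over `S = K[x_1, …, x_n]` with `A² = 0`. Passing to
vector space duals, `β_i(M)` is the dimension `h_i(Aᵀ)` of the degree `i` part of
`ker Aᵀ / im Aᵀ`, and `β_i(M^*)` is `h_i(A)` (`exists_matCohDim`).

To compare the two, let `s ∈ S` be such that multiplication by `s` is homotopic to zero for `A`,
that is, `s = A Φ + Φ A` for a matrix `Φ`. By transposition it is homotopic to zero for `Aᵀ` too, so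
`s` kills `ker Aᵀ / im Aᵀ`. Since `A` is triangular with respect to the grading of `M`, such a `Φ`
can be built column by column, each column imposing at most `h_i(A)` linear conditions on `s ∈ S_i`;
if `A` has `r` columns, these `s` therefore have codimension at most `r h_i(A)` in `S_i`. If
`ker Aᵀ` is generated in the degrees `a_1, …, a_N`, it follows that
`h_i(Aᵀ) ≤ ∑_k r h_{i - a_k}(A)` (`exists_matCohDim_transpose_le`), where only finitely many shifts
occur. Hence a bound of the form `α i^(c-1)` for one of the two sequences of Betti numbers gives one
for the other, and the complexities agree.
-/

namespace ExtAlg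

/-! ### Contractions and the Frobenius form of the exterior algebra -/

section Contraction

variable {K : Type u} [Field K] {n : ℕ}

/-- The generator `e_j` of `E`. -/
noncomputable def gen (j : Fin n) : E K n := ExteriorAlgebra.ι K (Pi.single j 1)

theorem gen_mem (j : Fin n) : (gen j : E K n) ∈ ⋀[K]^1 (Fin n → K) := by
  rw [ExteriorAlgebra.exteriorPower, pow_one]
  exact ⟨_, rfl⟩

/-- The augmentation `E → K`. -/
noncomputable abbrev aug : E K n →ₐ[K] K := ExteriorAlgebra.algebraMapInv

/-- The contraction `∂_j` of `E` with the `j`-th coordinate function: the antiderivation with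
`∂_j e_k = δ_{jk}`. -/
noncomputable def contr (j : Fin n) : Module.End K (E K n) :=
  CliffordAlgebra.contractLeft (LinearMap.proj j)

theorem contr_gen_mul (j k : Fin n) (x : E K n) :
    contr j (gen k * x) = (if j = k then x else 0) - gen k * contr j x := by
  refine (CliffordAlgebra.contractLeft_ι_mul (Q := (0 : QuadraticForm K (Fin n → K)))
    (LinearMap.proj j) (Pi.single k 1) x).trans ?_
  congr 1
  by_cases h : j = k
  · subst h; simp
  · simp [h]

theorem contr_one (j : Fin n) : contr j (1 : E K n) = 0 :=
  CliffordAlgebra.contractLeft_one (Q := (0 : QuadraticForm K (Fin n → K))) (LinearMap.proj j)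

theorem contr_contr_self (j : Fin n) (x : E K n) : contr j (contr j x) = 0 :=
  CliffordAlgebra.contractLeft_contractLeft (Q := (0 : QuadraticForm K (Fin n → K)))
    (LinearMap.proj j) x

theorem contr_comm (j k : Fin n) (x : E K n) : contr j (contr k x) = -contr k (contr j x) :=
  CliffordAlgebra.contractLeft_comm (Q := (0 : QuadraticForm K (Fin n → K)))
    (LinearMap.proj j) (LinearMap.proj k) x

theorem gen_mul_gen (j k : Fin n) : gen j * gen k = -(gen k * gen j : E K n) :=
  eq_neg_of_add_eq_zero_left (ExteriorAlgebra.ι_add_mul_swap _ _)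

theorem gen_mul_self (j : Fin n) : gen j * gen j = (0 : E K n) := ExteriorAlgebra.ι_sq_zero _

theorem aug_gen (j : Fin n) : aug (gen j : E K n) = 0 := by
  simp [gen, ExteriorAlgebra.algebraMapInv]

theorem ι_eq_sum_gen (v : Fin n → K) :
    ExteriorAlgebra.ι K v = ∑ j, algebraMap K (E K n) (v j) * gen j := by
  have hv : v = ∑ j, v j • (Pi.single j 1 : Fin n → K) := by
    ext i
    simp [Finset.sum_apply, Pi.single_apply]
  conv_lhs => rw [hv]
  simp only [map_sum, map_smul]
  simp only [Algebra.smul_def, gen]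

theorem exists_sum_gen (a : E K n) :
    ∃ b : Fin n → E K n, a = algebraMap K _ (aug a) + ∑ j, gen j * b j := by
  induction a using CliffordAlgebra.left_induction with
  | algebraMap r =>
    refine ⟨0, ?_⟩
    have : aug (algebraMap K (E K n) r) = r := ExteriorAlgebra.algebraMap_leftInverse _ r
    simp only [Pi.zero_apply, mul_zero, Finset.sum_const_zero, add_zero]
    exact (congrArg _ this).symm
  | add x y hx hy =>
    obtain ⟨b, hb⟩ := hx
    obtain ⟨c, hc⟩ := hy
    refine ⟨b + c, ?_⟩
    conv_lhs => rw [hb, hc]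
    simp only [map_add, Pi.add_apply, mul_add, Finset.sum_add_distrib]
    abel
  | ι_mul x v _ =>
    refine ⟨fun j => algebraMap K _ (v j) * x, ?_⟩
    have h0 : aug (ExteriorAlgebra.ι K v * x) = 0 := by
      rw [map_mul]
      simp [ExteriorAlgebra.algebraMapInv]
    change ExteriorAlgebra.ι K v * x = algebraMap K _ (aug (ExteriorAlgebra.ι K v * x)) + _
    rw [h0, map_zero, zero_add, ι_eq_sum_gen, Finset.sum_mul]
    refine Finset.sum_congr rfl fun j _ => ?_
    rw [← mul_assoc, Algebra.commutes]

/-- An element killed by all contractions is a scalar: apply the product of the operators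
`x ↦ x - e_j ∂_j x`, which fixes it, fixes `1` and kills every `e_j y`. -/
theorem eq_algebraMap_of_contr_eq_zero (w : E K n) (h : ∀ j, contr j w = 0) :
    w = algebraMap K _ (aug w) := by
  let q : Fin n → Module.End K (E K n) := fun j => 1 - LinearMap.mulLeft K (gen j) * contr j
  have hq : ∀ j x, q j x = x - gen j * contr j x := fun j x => rfl
  have h1 : ∀ (l : List (Fin n)) (x : E K n), (∀ j, contr j x = 0) →
      (l.map q).prod x = x := by
    intro l x hx
    induction l with
    | nil => rfl
    | cons a l ih =>
      rw [List.map_cons, List.prod_cons, Module.End.mul_apply, ih, hq, hx, mul_zero, sub_zero]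
  have h2 : ∀ (l : List (Fin n)) (k : Fin n) (x : E K n), ∃ y,
      (l.map q).prod (gen k * x) = gen k * y ∧ (k ∈ l → gen k * y = 0) := by
    intro l k x
    induction l with
    | nil => exact ⟨x, rfl, by simp⟩
    | cons a l ih =>
      obtain ⟨y, hy, hk⟩ := ih
      rw [List.map_cons, List.prod_cons, Module.End.mul_apply, hy, hq, contr_gen_mul]
      by_cases hak : a = k
      · subst hak
        refine ⟨0, ?_, by simp⟩
        rw [if_pos rfl, mul_sub, ← mul_assoc, gen_mul_self]
        simp
      · refine ⟨y - gen a * contr a y, ?_, fun hkl => ?_⟩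
        · rw [if_neg hak, zero_sub, mul_neg, ← mul_assoc, gen_mul_gen, mul_sub, ← mul_assoc]
          simp
        · have hkl : k ∈ l := by simpa [Ne.symm hak] using hkl
          have := congrArg (contr a) (hk hkl)
          rw [contr_gen_mul, if_neg hak, zero_sub, map_zero, neg_eq_zero] at this
          rw [mul_sub, hk hkl, ← mul_assoc, gen_mul_gen, neg_mul, mul_assoc, this]
          simp
  obtain ⟨b, hb⟩ := exists_sum_gen w
  have h3 := h1 (List.finRange n) w h
  rw [hb, map_add, map_sum, Finset.sum_eq_zero, add_zero, h1] at h3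
  · rw [← hb] at h3
    exact h3.symm
  · intro j
    rw [Algebra.algebraMap_eq_smul_one, map_smul, contr_one, smul_zero]
  · intro k _
    obtain ⟨y, hy, hk⟩ := h2 (List.finRange n) k (b k)
    rw [hy, hk (List.mem_finRange k)]

variable (K n) in
/-- The coefficient (up to sign) of `e_1 ⋯ e_n`, as the augmentation of the full contraction. -/
noncomputable def topCoeff : E K n →ₗ[K] K :=
  aug.toLinearMap ∘ₗ ((List.finRange n).map contr).prod

/-- The top coefficient does not vanish on nonzero elements of the socle. Contracting with one
generator after the other, the result stays nonzero, is killed by the contractions already made and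
by the generators still to come, and so is a nonzero scalar in the end. -/
theorem topCoeff_ne_zero_of_socle (y : E K n) (hy : y ≠ 0) (h : ∀ j, gen j * y = 0) :
    topCoeff K n y ≠ 0 := by
  have key : ∀ l : List (Fin n), l.Nodup →
      (l.map contr).prod y ≠ 0 ∧ (∀ j ∉ l, gen j * (l.map contr).prod y = 0) ∧
        ∀ j ∈ l, contr j ((l.map contr).prod y) = 0 := by
    intro l hl
    induction l with
    | nil => exact ⟨hy, fun j _ => h j, by simp⟩
    | cons a l ih =>
      obtain ⟨hal, hl⟩ := List.nodup_cons.1 hl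
      obtain ⟨h1, h2, h3⟩ := ih hl
      simp only [List.map_cons, List.prod_cons, Module.End.mul_apply]
      set z := (l.map contr).prod y with hz
      refine ⟨fun h0 => h1 ?_, fun j hj => ?_, fun j hj => ?_⟩
      · have := contr_gen_mul a a z
        rw [h2 a hal, h0] at this
        simpa using this.symm
      · rw [List.mem_cons, not_or] at hj
        have := contr_gen_mul a j z
        rw [h2 j hj.2, if_neg (Ne.symm hj.1)] at this
        simpa using this.symm
      · rcases List.mem_cons.1 hj with rfl | hj
        · exact contr_contr_self _ _
        · rw [contr_comm, h3 j hj, map_zero, neg_zero]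
  obtain ⟨h1, -, h3⟩ := key (List.finRange n) (List.nodup_finRange n)
  intro h0
  refine h1 ?_
  rw [eq_algebraMap_of_contr_eq_zero _ fun j => h3 j (List.mem_finRange j)]
  have : aug (((List.finRange n).map contr).prod y) = 0 := h0
  rw [this, map_zero]

/-- The form `(a, x) ↦ topCoeff (a x)` is nondegenerate: a nonzero left ideal meets the socle. -/
theorem exists_topCoeff_mul_ne_zero (x : E K n) (hx : x ≠ 0) :
    ∃ a, topCoeff K n (a * x) ≠ 0 := by
  have key : ∀ l : List (Fin n), ∃ a, a * x ≠ 0 ∧ ∀ j ∈ l, gen j * (a * x) = 0 := by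
    intro l
    induction l with
    | nil => exact ⟨1, by simpa using hx, by simp⟩
    | cons k l ih =>
      obtain ⟨a, ha, hl⟩ := ih
      by_cases hk : gen k * (a * x) = 0
      · exact ⟨a, ha, by simpa [hk] using hl⟩
      · refine ⟨gen k * a, by rwa [mul_assoc], fun j hj => ?_⟩
        rw [mul_assoc, ← mul_assoc (gen j)]
        rcases List.mem_cons.1 hj with rfl | hj
        · rw [gen_mul_self, zero_mul]
        · rw [gen_mul_gen, neg_mul, mul_assoc, hl j hj, mul_zero, neg_zero]
  obtain ⟨a, ha, h⟩ := key (List.finRange n)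
  exact ⟨a, topCoeff_ne_zero_of_socle _ ha fun j => h j (List.mem_finRange j)⟩

/-- Every `K`-linear functional on `E` is `a ↦ topCoeff (a x)` for some `x`. -/
theorem exists_topCoeff_mul_eq (g : E K n →ₗ[K] K) : ∃ x, ∀ a, topCoeff K n (a * x) = g a := by
  have : Module.Finite K (E K n) := finite_E
  let B : E K n →ₗ[K] Module.Dual K (E K n) :=
    ((LinearMap.mul K (E K n)).compr₂ (topCoeff K n)).flip
  have hB : Function.Injective B := by
    rw [injective_iff_map_eq_zero]
    intro x hx
    by_contra h
    obtain ⟨a, ha⟩ := exists_topCoeff_mul_ne_zero x h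
    exact ha (LinearMap.congr_fun hx a)
  obtain ⟨x, hx⟩ := (LinearMap.injective_iff_surjective_of_finrank_eq_finrank
    Subspace.dual_finrank_eq.symm).1 hB g
  exact ⟨x, fun a => LinearMap.congr_fun hx a⟩

end Contraction

/-! ### The dual as a vector space dual -/

section Dual

variable {K : Type u} [Field K] {n : ℕ}

/-- The `K`-vector space underlying an `E`-module. -/
@[reducible]
noncomputable def fieldModule (K : Type u) [Field K] (n : ℕ) (X : Type*) [AddCommGroup X]
    [Module (E K n) X] : Module K X :=
  Module.compHom X (algebraMap K (E K n))

noncomputable instance (M : GrMod K n) : Module K M.carrier := fieldModule K n M.carrier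

instance (M : GrMod K n) : IsScalarTower K (E K n) M.carrier := ⟨fun c a m => by
  change (c • a) • m = algebraMap K (E K n) c • a • m
  rw [Algebra.smul_def, mul_smul]⟩

instance (M : GrMod K n) : Module.Finite K M.carrier :=
  have : Module.Finite K (E K n) := finite_E
  Module.Finite.trans (E K n) M.carrier

/-- The sign `(-1)^(d(d-1)/2)`. -/
def binomSign (d : ℤ) : ℤˣ := (d * (d - 1) / 2).negOnePow

theorem binomSign_one_add (d : ℤ) : binomSign (1 + d) = d.negOnePow * binomSign d := by
  rw [binomSign, binomSign, ← Int.negOnePow_add]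
  congr 1
  have h : (1 + d) * (1 + d - 1) = d * (d - 1) + d * 2 := by ring
  rw [h, Int.add_mul_ediv_right _ _ (by norm_num), add_comm]

/-- The additive map multiplying `M_d` by `binomSign d`. -/
noncomputable def signTwist (M : GrMod K n) : M.carrier →+ M.carrier :=
  (DirectSum.toAddMonoid fun i : ℤ =>
    (DistribSMul.toAddMonoidHom M.carrier (binomSign i)).comp (M.piece i).subtype).comp
    (AddEquiv.ofBijective _ M.internal).symm.toAddMonoidHom

theorem signTwist_apply (M : GrMod K n) (i : ℤ) (m : M.carrier) (hm : m ∈ M.piece i) :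
    signTwist M m = binomSign i • m := by
  have : (AddEquiv.ofBijective _ M.internal).symm m =
      DirectSum.of (fun i => M.piece i) i ⟨m, hm⟩ := by
    rw [AddEquiv.symm_apply_eq]
    exact (DirectSum.coeAddMonoidHom_of M.piece i ⟨m, hm⟩).symm
  change DirectSum.toAddMonoid _ ((AddEquiv.ofBijective _ M.internal).symm m) = _
  rw [this, DirectSum.toAddMonoid_of]
  rfl

theorem signTwist_signTwist (M : GrMod K n) (m : M.carrier) : signTwist M (signTwist M m) = m := by
  induction m using piece_induction M with
  | h0 => simp
  | hom i m hm =>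
    rw [signTwist_apply M i m hm, signTwist_apply M i _ (by
      rw [Units.smul_def]; exact zsmul_mem hm _), smul_smul, Int.units_mul_self, one_smul]
  | add x y hx hy => rw [map_add, map_add, hx, hy]

/-- The twist exchanges the left and the right action of `E_1`. -/
theorem op_smul_signTwist (M : GrMod K n) (v : E K n) (hv : v ∈ ⋀[K]^1 (Fin n → K))
    (m : M.carrier) : MulOpposite.op v • signTwist M m = signTwist M (v • m) := by
  induction m using piece_induction M with
  | h0 => simp
  | hom i m hm =>
    have h := M.smul_mem 1 i v m hv hm
    rw [signTwist_apply M i m hm, signTwist_apply M _ _ h, M.smul_eq 1 i v m hv hm, smul_smul,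
      Nat.cast_one, one_mul, binomSign_one_add, mul_right_comm, Int.units_mul_self, one_mul,
      Units.smul_def, Units.smul_def, smul_comm]
  | add x y hx hy => simp only [smul_add, map_add, hx, hy]

theorem signTwist_smul (M : GrMod K n) (c : K) (m : M.carrier) :
    signTwist M (c • m) = c • signTwist M m := by
  induction m using piece_induction M with
  | h0 => simp
  | hom i m hm =>
    have h0 : algebraMap K (E K n) c ∈ ⋀[K]^0 (Fin n → K) := by
      rw [ExteriorAlgebra.exteriorPower, pow_zero]
      exact Submodule.algebraMap_mem c
    have h := M.smul_mem 0 i _ m h0 hm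
    rw [Nat.cast_zero, zero_add] at h
    rw [signTwist_apply M i m hm, signTwist_apply M i (c • m) h, Units.smul_def, Units.smul_def,
      smul_comm]
  | add x y hx hy => simp only [smul_add, map_add, hx, hy]

/-- The functional on `M` whose value at `m ∈ M_d` is `(-1)^(d(d-1)/2)` times the top coefficient
of `f m`. -/
noncomputable def topFunctional (M : GrMod K n) (f : M.carrier →ₗ[E K n] E K n) :
    Module.Dual K M.carrier where
  toFun m := topCoeff K n (f (signTwist M m))
  map_add' x y := by simp only [map_add]
  map_smul' c x := by rw [signTwist_smul, LinearMap.map_smul_of_tower, map_smul, RingHom.id_apply]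

/-- Up to the twist, a map `f` is recovered from its functional by the formula
`topCoeff (a f(m)) = topCoeff (f(a m))`, since the form `topCoeff (a x)` is nondegenerate. -/
theorem topFunctional_bijective (M : GrMod K n) : Function.Bijective (topFunctional M) := by
  have huniq : ∀ x y : E K n, (∀ a, topCoeff K n (a * x) = topCoeff K n (a * y)) → x = y := by
    intro x y hxy
    by_contra hne
    obtain ⟨a, ha⟩ := exists_topCoeff_mul_ne_zero _ (sub_ne_zero.2 hne)
    rw [mul_sub, map_sub, hxy, sub_self] at ha
    exact ha rfl
  constructor
  · intro f g hfg
    have h : ∀ m, topCoeff K n (f m) = topCoeff K n (g m) := fun m => by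
      rw [← signTwist_signTwist M m]
      exact LinearMap.congr_fun hfg (signTwist M m)
    refine LinearMap.ext fun m => huniq _ _ fun a => ?_
    rw [← smul_eq_mul, ← smul_eq_mul, ← map_smul, ← map_smul]
    exact h _
  · intro g
    have hex : ∀ m : M.carrier, ∃ x, ∀ a, topCoeff K n (a * x) = g (signTwist M (a • m)) := by
      intro m
      refine exists_topCoeff_mul_eq
        { toFun := fun a => g (signTwist M (a • m))
          map_add' := fun a b => by rw [add_smul, map_add, map_add]
          map_smul' := fun c a => by
            rw [smul_assoc, signTwist_smul, map_smul, RingHom.id_apply] }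
    choose F hF using hex
    refine ⟨{
        toFun := F
        map_add' := fun x y => huniq _ _ fun a => by
          rw [mul_add, map_add, hF, hF, hF, smul_add, map_add, map_add]
        map_smul' := fun b x => huniq _ _ fun a => by
          rw [RingHom.id_apply, smul_eq_mul, ← mul_assoc, hF, hF, mul_smul] }, ?_⟩
    refine LinearMap.ext fun m => ?_
    change topCoeff K n (F (signTwist M m)) = g m
    have := hF (signTwist M m) 1
    rwa [one_mul, one_smul, signTwist_signTwist] at this

theorem topFunctional_field_smul (M : GrMod K n) (c : K) (f : M.carrier →ₗ[E K n] E K n)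
    (m : M.carrier) :
    topCoeff K n (f (MulOpposite.op (algebraMap K (E K n) c) • signTwist M m)) =
      c • topCoeff K n (f (signTwist M m)) := by
  rw [smul_eq_smul_of_field, map_smul, algebraMap_smul, map_smul]

theorem topFunctional_smul (M : GrMod K n) (v : E K n) (hv : v ∈ ⋀[K]^1 (Fin n → K))
    (f : M.carrier →ₗ[E K n] E K n) (m : M.carrier) :
    topCoeff K n (f (MulOpposite.op v • signTwist M m)) =
      topCoeff K n (f (signTwist M (v • m))) := by
  rw [op_smul_signTwist M v hv]

/-- `M^* = Hom_E(M, E)` is the `K`-dual of `M`. It is so because the top coefficient is a Frobenius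
form on `E`; with the sign in `topFunctional`, the left action of `v ∈ E_1` on `M^*` becomes the
transpose of the left action on `M`. -/
noncomputable def dualEquiv (M : GrMod K n) :
    M.dual.carrier ≃ₗ[K] Module.Dual K M.carrier :=
  LinearEquiv.ofBijective
    ({ toFun := fun f => topFunctional M f
       map_add' := fun _ _ => LinearMap.ext fun _ => map_add (topCoeff K n) _ _
       map_smul' := fun c f => LinearMap.ext fun m => topFunctional_field_smul M c f m } :
      M.dual.carrier →ₗ[K] Module.Dual K M.carrier) (topFunctional_bijective M)

theorem dualEquiv_smul (M : GrMod K n) (v : E K n) (hv : v ∈ ⋀[K]^1 (Fin n → K))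
    (f : M.dual.carrier) (m : M.carrier) : dualEquiv M (v • f) m = dualEquiv M f (v • m) :=
  topFunctional_smul M v hv f m

end Dual

/-! ### Regular sequences of anticommuting operators -/

section Operators

variable {K : Type*} [Field K] {X : Type*} [AddCommGroup X] [Module K X]

/-- The subspace `v_0 X + ⋯ + v_{k-1} X`. -/
def rangeSum (v : ℕ → Module.End K X) : ℕ → Submodule K X
  | 0 => ⊥
  | k + 1 => rangeSum v k ⊔ LinearMap.range (v k)

/-- The intersection of the kernels of `v_0, …, v_{k-1}`. -/
def kerInf (v : ℕ → Module.End K X) : ℕ → Submodule K X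
  | 0 => ⊤
  | k + 1 => kerInf v k ⊓ LinearMap.ker (v k)

/-- The product `v_{k-1} ⋯ v_0`. -/
def opProd (v : ℕ → Module.End K X) : ℕ → Module.End K X
  | 0 => 1
  | k + 1 => v k * opProd v k

/-- The operators square to zero and anticommute. -/
structure Anticommute {ι : Type*} (v : ι → Module.End K X) : Prop where
  sq : ∀ i, v i * v i = 0
  swap : ∀ i j, v i * v j = -(v j * v i)

variable {v : ℕ → Module.End K X}

theorem Anticommute.opProd_mul (h : Anticommute v) (k j : ℕ) :
    opProd v k * v j = ((-1 : ℤˣ) ^ k) • (v j * opProd v k) := by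
  induction k with
  | zero => simp [opProd]
  | succ k ih =>
    rw [opProd, mul_assoc, ih, mul_smul_comm, ← mul_assoc, h.swap k j, pow_succ, mul_smul]
    simp [mul_assoc]

theorem Anticommute.opProd_mul_of_lt (h : Anticommute v) {k j : ℕ} (hj : j < k) :
    opProd v k * v j = 0 := by
  induction k with
  | zero => omega
  | succ k ih =>
    rw [opProd, mul_assoc]
    rcases Nat.lt_succ_iff_lt_or_eq.1 hj with hj | rfl
    · rw [ih hj, mul_zero]
    · rw [h.opProd_mul, mul_smul_comm, ← mul_assoc, h.sq, zero_mul, smul_zero]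

theorem rangeSum_le_iff {k : ℕ} {W : Submodule K X} :
    rangeSum v k ≤ W ↔ ∀ j < k, LinearMap.range (v j) ≤ W := by
  induction k with
  | zero => simp [rangeSum]
  | succ k ih =>
    rw [rangeSum, sup_le_iff, ih]
    simp only [Nat.lt_succ_iff_lt_or_eq, or_imp, forall_and, forall_eq]

theorem Anticommute.rangeSum_le_ker (h : Anticommute v) (k : ℕ) :
    rangeSum v k ≤ LinearMap.ker (opProd v k) := by
  rw [rangeSum_le_iff]
  rintro j hj _ ⟨x, rfl⟩
  exact LinearMap.congr_fun (h.opProd_mul_of_lt hj) x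

/-- Up to sign, it does not matter on which side `v_k` is multiplied. -/
theorem Anticommute.opProd_apply_eq_zero_iff (h : Anticommute v) (k : ℕ) (x : X) :
    opProd v k (v k x) = 0 ↔ opProd v (k + 1) x = 0 := by
  have := LinearMap.congr_fun (h.opProd_mul k k) x
  rw [Module.End.mul_apply, LinearMap.smul_apply, ← opProd] at this
  rw [this, smul_eq_zero_iff_eq]

/-- Regularity of the whole sequence amounts to one equation: the kernel of the product of the
operators is the sum of their images. -/
theorem Anticommute.regular_iff (h : Anticommute v) (s : ℕ) :
    (∀ k < s, ∀ x, v k x ∈ rangeSum v k → x ∈ rangeSum v (k + 1)) ↔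
      LinearMap.ker (opProd v s) = rangeSum v s := by
  induction s with
  | zero => simp [opProd, rangeSum, Module.End.one_eq_id]
  | succ s ih =>
    simp only [Nat.lt_succ_iff_lt_or_eq, or_imp, forall_and, forall_eq]
    rw [ih]
    constructor
    · rintro ⟨h1, h2⟩
      refine le_antisymm (fun x hx => h2 x ?_) (h.rangeSum_le_ker _)
      rw [← h1, LinearMap.mem_ker, h.opProd_apply_eq_zero_iff]
      exact hx
    · intro h1
      refine ⟨le_antisymm (fun x hx => ?_) (h.rangeSum_le_ker _), fun x hx => ?_⟩
      · have hx1 : x ∈ rangeSum v (s + 1) := by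
          rw [← h1, LinearMap.mem_ker, opProd, Module.End.mul_apply, LinearMap.mem_ker.1 hx,
            map_zero]
        obtain ⟨w, hw, _, ⟨y, rfl⟩, rfl⟩ := Submodule.mem_sup.1 hx1
        have hy : opProd v s (v s y) = 0 := by
          have := LinearMap.mem_ker.1 hx
          rwa [map_add, LinearMap.mem_ker.1 (h.rangeSum_le_ker s hw), zero_add] at this
        rw [h.opProd_apply_eq_zero_iff, ← LinearMap.mem_ker, h1] at hy
        obtain ⟨w', hw', _, ⟨y', rfl⟩, rfl⟩ := Submodule.mem_sup.1 hy
        refine add_mem hw ?_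
        have h0 : v s (v s y') = 0 := LinearMap.congr_fun (h.sq s) y'
        rw [map_add, h0, add_zero]
        have hmap : rangeSum v s ≤ (rangeSum v s).comap (v s) := by
          rw [rangeSum_le_iff]
          rintro j hj _ ⟨z, rfl⟩
          have : v s (v j z) = -(v j (v s z)) := LinearMap.congr_fun (h.swap s j) z
          rw [Submodule.mem_comap, this, neg_mem_iff]
          exact rangeSum_le_iff.1 le_rfl j hj ⟨_, rfl⟩
        exact hmap hw'
      · rw [← h1, LinearMap.mem_ker, ← h.opProd_apply_eq_zero_iff]
        exact h.rangeSum_le_ker s hx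

/-- For a regular sequence, the image of the product of the operators is the intersection of their
kernels. On duals this is the condition of `Anticommute.regular_iff` for the transposes. -/
theorem Anticommute.range_eq_kerInf (h : Anticommute v) (s : ℕ)
    (hs : LinearMap.ker (opProd v s) = rangeSum v s) :
    LinearMap.range (opProd v s) = kerInf v s := by
  rw [← h.regular_iff] at hs
  induction s with
  | zero => simp [opProd, kerInf, Module.End.one_eq_id]
  | succ s ih =>
    have hs' := (h.regular_iff s).1 fun k hk => hs k (by omega)
    have ih := ih fun k hk => hs k (by omega)
    apply le_antisymm
    · rintro _ ⟨x, rfl⟩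
      refine ⟨?_, ?_⟩
      · have := LinearMap.congr_fun (h.opProd_mul s s) x
        rw [Module.End.mul_apply, LinearMap.smul_apply, ← opProd, eq_comm, smul_eq_iff_eq_inv_smul]
          at this
        rw [this, Units.smul_def, ← ih]
        exact zsmul_mem (LinearMap.mem_range_self _ _) _
      · change v s (opProd v (s + 1) x) = 0
        rw [opProd, Module.End.mul_apply, ← Module.End.mul_apply, h.sq]
        rfl
    · rintro x ⟨hx1, hx2⟩
      rw [SetLike.mem_coe, ← ih] at hx1
      obtain ⟨y, rfl⟩ := hx1
      have hy : y ∈ rangeSum v (s + 1) := by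
        rw [← (h.regular_iff (s + 1)).1 hs]
        exact hx2
      obtain ⟨w, hw, _, ⟨y', rfl⟩, rfl⟩ := Submodule.mem_sup.1 hy
      rw [map_add, LinearMap.mem_ker.1 (h.rangeSum_le_ker s hw), zero_add,
        ← Module.End.mul_apply, h.opProd_mul, LinearMap.smul_apply, Units.smul_def]
      exact zsmul_mem (LinearMap.mem_range_self _ _) _

variable (v) in
/-- The transposed operators. -/
def transposeOps : ℕ → Module.End K (Module.Dual K X) := fun j => (v j).dualMap

theorem Anticommute.transposeOps (h : Anticommute v) : Anticommute (transposeOps v) where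
  sq i := by
    ext f x
    have : v i (v i x) = 0 := LinearMap.congr_fun (h.sq i) x
    change f (v i (v i x)) = 0
    rw [this, map_zero]
  swap i j := by
    ext f x
    have : v j (v i x) = -(v i (v j x)) := LinearMap.congr_fun (h.swap j i) x
    change f (v j (v i x)) = -f (v i (v j x))
    rw [this, map_neg]

/-- The product of the transposes is the transpose of the product in the opposite order, and
reversing the order costs a sign. -/
theorem Anticommute.opProd_transposeOps (h : Anticommute v) (k : ℕ) :
    ∃ u : ℤˣ, opProd (ExtAlg.transposeOps v) k = u • (opProd v k).dualMap := by
  induction k with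
  | zero =>
    refine ⟨1, ?_⟩
    ext f x
    simp [opProd]
  | succ k ih =>
    obtain ⟨u, hu⟩ := ih
    refine ⟨u * (-1) ^ k, ?_⟩
    ext f x
    have := LinearMap.congr_fun (h.opProd_mul k k) x
    rw [Module.End.mul_apply, LinearMap.smul_apply, ← opProd] at this
    rw [opProd, hu, mul_smul_comm, mul_smul]
    simp only [LinearMap.smul_apply, Units.smul_def]
    congr 1
    change f (opProd v k (v k x)) = _
    rw [this, Units.smul_def, map_zsmul]
    rfl

theorem Anticommute.ker_opProd_transposeOps (h : Anticommute v) (k : ℕ) :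
    LinearMap.ker (opProd (ExtAlg.transposeOps v) k) =
      (LinearMap.range (opProd v k)).dualAnnihilator := by
  obtain ⟨u, hu⟩ := h.opProd_transposeOps k
  rw [← LinearMap.ker_dualMap_eq_dualAnnihilator_range, hu]
  ext f
  simp only [LinearMap.mem_ker, LinearMap.smul_apply, smul_eq_zero_iff_eq]

theorem Anticommute.range_opProd_transposeOps (h : Anticommute v) (k : ℕ) :
    LinearMap.range (opProd (ExtAlg.transposeOps v) k) =
      (LinearMap.ker (opProd v k)).dualAnnihilator := by
  obtain ⟨u, hu⟩ := h.opProd_transposeOps k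
  rw [← LinearMap.range_dualMap_eq_dualAnnihilator_ker, hu]
  ext f
  constructor
  · rintro ⟨x, rfl⟩
    rw [LinearMap.smul_apply, Units.smul_def]
    exact zsmul_mem (LinearMap.mem_range_self _ x) _
  · rintro ⟨x, rfl⟩
    refine ⟨u • x, ?_⟩
    rw [LinearMap.smul_apply, Units.smul_def, Units.smul_def, map_zsmul, smul_smul,
      ← Units.val_mul, Int.units_mul_self]
    simp

theorem dualAnnihilator_rangeSum (k : ℕ) :
    (rangeSum v k).dualAnnihilator = kerInf (transposeOps v) k := by
  induction k with
  | zero => simp [rangeSum, kerInf]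
  | succ k ih =>
    rw [rangeSum, kerInf, Submodule.dualAnnihilator_sup_eq, ih, transposeOps,
      LinearMap.ker_dualMap_eq_dualAnnihilator_range]

theorem dualAnnihilator_kerInf (k : ℕ) :
    (kerInf v k).dualAnnihilator = rangeSum (transposeOps v) k := by
  induction k with
  | zero => simp [rangeSum, kerInf]
  | succ k ih =>
    rw [rangeSum, kerInf, Subspace.dualAnnihilator_inf_eq, ih, transposeOps,
      LinearMap.range_dualMap_eq_dualAnnihilator_ker]

theorem Anticommute.ker_eq_rangeSum_transposeOps_iff (h : Anticommute v) (s : ℕ) :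
    LinearMap.ker (opProd (ExtAlg.transposeOps v) s) = rangeSum (ExtAlg.transposeOps v) s ↔
      LinearMap.ker (opProd v s) = rangeSum v s := by
  constructor
  · intro h1
    have h2 := h.transposeOps.range_eq_kerInf s h1
    rw [h.range_opProd_transposeOps, ← dualAnnihilator_rangeSum] at h2
    exact Subspace.dualAnnihilator_inj.1 h2
  · intro h1
    rw [h.ker_opProd_transposeOps, h.range_eq_kerInf s h1, dualAnnihilator_kerInf]

/-- A sequence of anticommuting operators of square zero is regular if and only if the sequence
of the transposes is. -/
theorem Anticommute.isRegular_transposeOps_iff (h : Anticommute v) (s : ℕ) :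
    ((∀ k < s, ∀ f, ExtAlg.transposeOps v k f ∈ rangeSum (ExtAlg.transposeOps v) k →
        f ∈ rangeSum (ExtAlg.transposeOps v) (k + 1)) ∧ rangeSum (ExtAlg.transposeOps v) s ≠ ⊤) ↔
      (∀ k < s, ∀ x, v k x ∈ rangeSum v k → x ∈ rangeSum v (k + 1)) ∧ rangeSum v s ≠ ⊤ := by
  rw [h.regular_iff, h.transposeOps.regular_iff, h.ker_eq_rangeSum_transposeOps_iff]
  refine and_congr_right fun h1 => not_congr ?_
  rw [← h1, ← (h.ker_eq_rangeSum_transposeOps_iff s).2 h1, h.ker_opProd_transposeOps,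
    LinearMap.ker_eq_top, ← Submodule.dualAnnihilator_bot, Subspace.dualAnnihilator_inj,
    LinearMap.range_eq_bot]

end Operators

section Transfer

variable {K : Type*} [Field K] {X Y : Type*} [AddCommGroup X] [Module K X] [AddCommGroup Y]
  [Module K Y] {v : ℕ → Module.End K X} {w : ℕ → Module.End K Y}

theorem mem_rangeSum_equiv (e : X ≃ₗ[K] Y) (he : ∀ j x, e (v j x) = w j (e x)) (k : ℕ) (x : X) :
    e x ∈ rangeSum w k ↔ x ∈ rangeSum v k := by
  have key : ∀ k, (rangeSum v k).map (e : X →ₗ[K] Y) = rangeSum w k := by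
    intro k
    induction k with
    | zero => simp [rangeSum]
    | succ k ih =>
      rw [rangeSum, rangeSum, Submodule.map_sup, ih]
      congr 1
      ext y
      constructor
      · rintro ⟨_, ⟨x, rfl⟩, rfl⟩
        exact ⟨e x, (he k x).symm⟩
      · rintro ⟨y, rfl⟩
        obtain ⟨x, rfl⟩ := e.surjective y
        exact ⟨v k x, ⟨x, rfl⟩, he k x⟩
  rw [← key k]
  exact ⟨fun ⟨y, hy, hxy⟩ => e.injective hxy ▸ hy, fun hx => ⟨x, hx, rfl⟩⟩

theorem isRegular_equiv (e : X ≃ₗ[K] Y) (he : ∀ j x, e (v j x) = w j (e x)) (s : ℕ) :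
    ((∀ k < s, ∀ x, v k x ∈ rangeSum v k → x ∈ rangeSum v (k + 1)) ∧ rangeSum v s ≠ ⊤) ↔
      (∀ k < s, ∀ y, w k y ∈ rangeSum w k → y ∈ rangeSum w (k + 1)) ∧ rangeSum w s ≠ ⊤ := by
  refine and_congr (forall₂_congr fun k _ => ?_) (not_congr ?_)
  · rw [e.surjective.forall]
    simp only [← he, mem_rangeSum_equiv e he]
  · rw [Submodule.eq_top_iff', Submodule.eq_top_iff', e.surjective.forall]
    simp only [mem_rangeSum_equiv e he]

end Transfer

section RegularSeq

variable {K : Type u} [Field K] {n : ℕ} {X : Type*} [AddCommGroup X] [Module (E K n) X]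
  [Module K X] [IsScalarTower K (E K n) X]

/-- The operators by which a finite sequence in `E_1` acts, continued by zero. -/
noncomputable def seqOps (X : Type*) [AddCommGroup X] [Module (E K n) X]
    [Module K X] [IsScalarTower K (E K n) X] {s : ℕ} (v : Fin s → ⋀[K]^1 (Fin n → K)) (j : ℕ) :
    Module.End K X :=
  if h : j < s then Algebra.lsmul K K X (v ⟨j, h⟩ : E K n) else 0

theorem exists_ι_eq (v : ⋀[K]^1 (Fin n → K)) : ∃ w, ExteriorAlgebra.ι K w = (v : E K n) := by
  obtain ⟨v, hv⟩ := v
  change v ∈ LinearMap.range (ExteriorAlgebra.ι K) ^ 1 at hv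
  rwa [pow_one] at hv

variable {s : ℕ} (v : Fin s → ⋀[K]^1 (Fin n → K))

theorem seqOps_apply (i : Fin s) (x : X) : seqOps X v i x = (v i : E K n) • x := by
  rw [seqOps, dif_pos i.2]
  rfl

theorem anticommute_seqOps : Anticommute (seqOps X v) where
  sq i := by
    rw [seqOps]
    split_ifs
    · obtain ⟨w, hw⟩ := exists_ι_eq (v ⟨i, ‹_›⟩)
      rw [← map_mul, ← hw, ExteriorAlgebra.ι_sq_zero, map_zero]
    · rw [mul_zero]
  swap i j := by
    rw [seqOps, seqOps]
    split_ifs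
    · obtain ⟨w, hw⟩ := exists_ι_eq (v ⟨i, ‹_›⟩)
      obtain ⟨w', hw'⟩ := exists_ι_eq (v ⟨j, ‹_›⟩)
      rw [← map_mul, ← hw, ← hw', eq_neg_of_add_eq_zero_left (ExteriorAlgebra.ι_add_mul_swap w w'),
        map_neg, map_mul]
    all_goals simp

/-- The `K`-subspace `v_0 X + ⋯ + v_{k-1} X` is an `E`-submodule. -/
theorem smul_mem_rangeSum_seqOps (k : ℕ) (a : E K n) (x : X) (hx : x ∈ rangeSum (seqOps X v) k) :
    a • x ∈ rangeSum (seqOps X v) k := by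
  induction a using ExteriorAlgebra.induction generalizing x with
  | algebraMap r => rw [algebraMap_smul]; exact Submodule.smul_mem _ _ hx
  | ι w =>
    have h : rangeSum (seqOps X v) k ≤
        (rangeSum (seqOps X v) k).comap (Algebra.lsmul K K X (ExteriorAlgebra.ι K w)) := by
      rw [rangeSum_le_iff]
      rintro j hj _ ⟨z, rfl⟩
      change ExteriorAlgebra.ι K w • seqOps X v j z ∈ rangeSum (seqOps X v) k
      by_cases hs : j < s
      · have := seqOps_apply (X := X) v ⟨j, hs⟩
        simp only at this
        obtain ⟨w', hw'⟩ := exists_ι_eq (v ⟨j, hs⟩)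
        rw [this, smul_smul, ← hw', eq_neg_of_add_eq_zero_left
          (ExteriorAlgebra.ι_add_mul_swap w w'), hw', neg_smul, mul_smul, ← this, neg_mem_iff]
        exact rangeSum_le_iff.1 le_rfl j hj ⟨_, rfl⟩
      · have : seqOps X v j = 0 := dif_neg hs
        rw [this, LinearMap.zero_apply, smul_zero]
        exact zero_mem _
    exact h hx
  | mul a b ha hb => rw [mul_smul]; exact ha _ (hb _ hx)
  | add a b ha hb => rw [add_smul]; exact add_mem (ha _ hx) (hb _ hx)

theorem mem_span_smul_top_iff (k : ℕ) (x : X) :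
    x ∈ Ideal.span {a : E K n | ∃ j : Fin s, (j : ℕ) < k ∧ a = v j} • (⊤ : Submodule (E K n) X) ↔
      x ∈ rangeSum (seqOps X v) k := by
  constructor
  · intro hx
    refine Submodule.smul_induction_on hx (fun a ha y _ => ?_) fun x y hx hy => add_mem hx hy
    induction ha using Submodule.span_induction with
    | mem a ha =>
      obtain ⟨j, hj, rfl⟩ := ha
      rw [← seqOps_apply]
      exact rangeSum_le_iff.1 le_rfl j hj ⟨_, rfl⟩
    | zero => rw [zero_smul]; exact zero_mem _
    | add a b _ _ ha hb => rw [add_smul]; exact add_mem ha hb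
    | smul a b _ hb => rw [smul_assoc]; exact smul_mem_rangeSum_seqOps v k a _ hb
  · have h : rangeSum (seqOps X v) k ≤
        (Ideal.span {a : E K n | ∃ j : Fin s, (j : ℕ) < k ∧ a = v j} •
          (⊤ : Submodule (E K n) X)).restrictScalars K := by
      rw [rangeSum_le_iff]
      rintro j hj _ ⟨z, rfl⟩
      by_cases hs : j < s
      · have := seqOps_apply (X := X) v ⟨j, hs⟩ z
        simp only at this
        have hv : (v ⟨j, hs⟩ : E K n) ∈
            Ideal.span {a : E K n | ∃ j : Fin s, (j : ℕ) < k ∧ a = v j} :=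
          Ideal.subset_span ⟨⟨j, hs⟩, hj, rfl⟩
        rw [this, Submodule.restrictScalars_mem]
        exact Submodule.smul_mem_smul hv Submodule.mem_top
      · have : seqOps X v j = 0 := dif_neg hs
        rw [this, LinearMap.zero_apply]
        exact zero_mem _
    exact fun hx => h hx

/-- Regular sequences in terms of the operators: as `v_k² = 0`, only the inclusion of the
annihilator of `v_k` in the image of `v_k` is a condition. -/
theorem isRegularSeq_iff :
    IsRegularSeq X v ↔ (∀ k < s, ∀ x, seqOps X v k x ∈ rangeSum (seqOps X v) k →
      x ∈ rangeSum (seqOps X v) (k + 1)) ∧ rangeSum (seqOps X v) s ≠ ⊤ := by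
  refine and_congr ?_ ?_
  · rw [← Fin.forall_iff (p := fun k : Fin s => ∀ x, seqOps X v k x ∈ rangeSum (seqOps X v) k →
      x ∈ rangeSum (seqOps X v) (k + 1))]
    refine forall_congr' fun i => ?_
    rw [IsRegularOn, Set.ext_iff, (Submodule.Quotient.mk_surjective _).forall]
    simp only [Set.mem_ofPred_eq, (Submodule.Quotient.mk_surjective _).exists,
      ← Submodule.Quotient.mk_smul, Submodule.Quotient.mk_eq_zero, Submodule.Quotient.eq,
      Fin.lt_def, mem_span_smul_top_iff]
    simp only [← seqOps_apply (X := X)]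
    refine forall_congr' fun x => ⟨fun h hx => ?_, fun h => ⟨fun hx => ?_, ?_⟩⟩
    · obtain ⟨y, hy⟩ := h.1 hx
      have := Submodule.add_mem_sup hy (LinearMap.mem_range_self (seqOps X v i) y)
      rwa [sub_add_cancel] at this
    · obtain ⟨w, hw, _, ⟨y, rfl⟩, rfl⟩ := Submodule.mem_sup.1 (h hx)
      exact ⟨y, by rwa [add_sub_cancel_right]⟩
    · rintro ⟨y, hy⟩
      have h1 : seqOps X v i (seqOps X v i y) = 0 :=
        LinearMap.congr_fun ((anticommute_seqOps v).sq i) y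
      have h2 := smul_mem_rangeSum_seqOps v i (v i) _ hy
      rwa [← seqOps_apply, map_sub, h1, sub_zero] at h2
  · rw [Submodule.Quotient.nontrivial_iff, not_iff_not, Submodule.eq_top_iff',
      Submodule.eq_top_iff']
    refine forall_congr' fun x => ?_
    rw [← mem_span_smul_top_iff]
    simp

/-- Regular sequences on `M` and on `M^*` agree, as `E_1` acts on `M^*` by transposes. -/
theorem isRegularSeq_dual_iff (M : GrMod K n) :
    IsRegularSeq M.carrier v ↔ IsRegularSeq M.dual.carrier v := by
  rw [isRegularSeq_iff, isRegularSeq_iff, ← (anticommute_seqOps v).isRegular_transposeOps_iff,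
    isRegular_equiv (dualEquiv M) (w := transposeOps (seqOps M.carrier v))]
  intro j f
  ext m
  by_cases hj : j < s
  · have h1 := seqOps_apply (X := M.dual.carrier) v ⟨j, hj⟩ f
    have h2 := seqOps_apply (X := M.carrier) v ⟨j, hj⟩ m
    simp only at h1 h2
    change _ = dualEquiv M f (seqOps M.carrier v j m)
    rw [h1, h2, dualEquiv_smul M _ (v ⟨j, hj⟩).2]
  · have h1 : seqOps M.dual.carrier v j = 0 := dif_neg hj
    have h2 : seqOps M.carrier v j = 0 := dif_neg hj
    change _ = dualEquiv M f (seqOps M.carrier v j m)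
    rw [h1, h2]
    simp

end RegularSeq

/-! ### Matrices of linear forms and their transposes -/

section HomogeneousPolynomials

open MvPolynomial

variable (σ K : Type*) [Field K]

/-- The polynomials that are homogeneous of degree `i - 1`; only `0` if `i = 0`. -/
noncomputable def homPred : ℕ → Submodule K (MvPolynomial σ K)
  | 0 => ⊥
  | i + 1 => homogeneousSubmodule σ K i

variable {σ K}

theorem mul_mem_of_mem_homPred {i : ℕ} {f g : MvPolynomial σ K} (hf : f.IsHomogeneous 1)
    (hg : g ∈ homPred σ K i) : f * g ∈ homogeneousSubmodule σ K i := by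
  cases i with
  | zero => rw [(Submodule.mem_bot K).1 hg, mul_zero]; exact zero_mem _
  | succ i => rw [add_comm]; exact hf.mul hg

theorem mul_mem_homPred {a i : ℕ} {f g : MvPolynomial σ K} (hf : f.IsHomogeneous a)
    (hg : g ∈ homPred σ K i) : f * g ∈ homPred σ K (a + i) := by
  cases i with
  | zero => rw [(Submodule.mem_bot K).1 hg, mul_zero]; exact zero_mem _
  | succ i => exact hf.mul hg

theorem homogeneousComponent_mul_of_isHomogeneous {a : ℕ} {f : MvPolynomial σ K}
    (hf : f.IsHomogeneous a) (c : MvPolynomial σ K) (i : ℕ) :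
    homogeneousComponent i (c * f) = if a ≤ i then homogeneousComponent (i - a) c * f else 0 := by
  have h : ∀ j, homogeneousComponent i (homogeneousComponent j c * f) =
      if i = j + a then homogeneousComponent j c * f else 0 := fun j =>
    homogeneousComponent_of_mem ((homogeneousComponent_isHomogeneous j c).mul hf)
  conv_lhs => rw [← sum_homogeneousComponent c, Finset.sum_mul, map_sum]
  simp only [h]
  split_ifs with hai
  · rw [Finset.sum_eq_single (i - a)]
    · rw [if_pos (by omega)]
    · intro b _ hb
      rw [if_neg (by omega)]
    · intro hb
      rw [homogeneousComponent_eq_zero _ _ (by rw [Finset.mem_range] at hb; omega), zero_mul,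
        ite_self]
  · exact Finset.sum_eq_zero fun j _ => if_neg (by omega)

instance [Finite σ] (i : ℕ) : Module.Finite K (homogeneousSubmodule σ K i) :=
  Module.Finite.iff_fg.2 (homogeneousSubmodule_fg σ K i)

instance [Finite σ] (i : ℕ) : Module.Finite K (homPred σ K i) := by
  cases i with
  | zero => exact inferInstanceAs (Module.Finite K (⊥ : Submodule K _))
  | succ i => exact inferInstanceAs (Module.Finite K (homogeneousSubmodule σ K i))

end HomogeneousPolynomials

section LinearAlgebra

variable {K : Type*} [Field K] {L V W : Type*} [AddCommGroup L] [Module K L] [AddCommGroup V]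
  [Module K V] [AddCommGroup W] [Module K W]

/-- If `o` takes values in `Z`, then passing from `L` to the elements that `o` sends to `B` lowers
the dimension of the image under `p` by at most `dim Z / B`. -/
theorem finrank_range_le_add (p : L →ₗ[K] V) (o : L →ₗ[K] W) (Z B : Submodule K W)
    [Module.Finite K Z] [Module.Finite K (LinearMap.range p)] (hB : B ≤ Z)
    (ho : ∀ x, o x ∈ Z) :
    Module.finrank K (LinearMap.range p) ≤ Module.finrank K ((B.comap o).map p) +
      (Module.finrank K Z - Module.finrank K B) := by
  obtain ⟨C, hC⟩ := (B.comap o).exists_isCompl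
  have hinj : Function.Injective (o.domRestrict C) := by
    rw [injective_iff_map_eq_zero]
    rintro ⟨x, hx⟩ h0
    have h0 : o x = 0 := h0
    have : x ∈ B.comap o := by rw [Submodule.mem_comap, h0]; exact zero_mem _
    simpa using hC.disjoint.le_bot ⟨this, hx⟩
  have hle : LinearMap.range (o.domRestrict C) ≤ Z := by
    rintro _ ⟨x, rfl⟩
    exact ho x
  have hdis : Disjoint B (LinearMap.range (o.domRestrict C)) := by
    rw [Submodule.disjoint_def]
    rintro _ hx ⟨⟨x, hxC⟩, rfl⟩
    have : x = 0 := by simpa using hC.disjoint.le_bot ⟨hx, hxC⟩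
    subst this
    exact map_zero o
  have : Module.Finite K B := Submodule.finiteDimensional_of_le hB
  have : Module.Finite K (LinearMap.range (o.domRestrict C)) :=
    Submodule.finiteDimensional_of_le hle
  have e := LinearEquiv.ofInjective _ hinj
  have : Module.Finite K C := Module.Finite.equiv e.symm
  have h1 := Submodule.finrank_sup_add_finrank_inf_eq B (LinearMap.range (o.domRestrict C))
  rw [hdis.eq_bot, finrank_bot, add_zero, ← e.finrank_eq] at h1
  have h2 := Submodule.finrank_mono (sup_le hB hle)
  have h3 : LinearMap.range p = (B.comap o).map p ⊔ C.map p := by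
    rw [← Submodule.map_sup, hC.sup_eq_top, Submodule.map_top]
  have : Module.Finite K ((B.comap o).map p) :=
    Submodule.finiteDimensional_of_le (LinearMap.map_le_range)
  have h4 := Submodule.finrank_add_le_finrank_add_finrank ((B.comap o).map p) (C.map p)
  rw [← h3] at h4
  have h5 := Submodule.finrank_map_le p C
  omega

end LinearAlgebra

section MatrixComplex

open MvPolynomial Matrix

variable {σ K : Type*} [Field K] {r : Type*} [Fintype r]

/-- Multiplication by a matrix of polynomials, as a `K`-linear map. -/
noncomputable def mulVecK (A : Matrix r r (MvPolynomial σ K)) :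
    (r → MvPolynomial σ K) →ₗ[K] (r → MvPolynomial σ K) :=
  (A.mulVecLin).restrictScalars K

/-- The degree `i` cocycles of a matrix of linear forms: the homogeneous vectors in its kernel. -/
noncomputable def cocyc (A : Matrix r r (MvPolynomial σ K)) (i : ℕ) :
    Submodule K (r → MvPolynomial σ K) :=
  Submodule.pi Set.univ (fun _ => homogeneousSubmodule σ K i) ⊓ LinearMap.ker (mulVecK A)

/-- The degree `i` coboundaries of a matrix of linear forms. -/
noncomputable def cobd (A : Matrix r r (MvPolynomial σ K)) (i : ℕ) :
    Submodule K (r → MvPolynomial σ K) :=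
  (Submodule.pi Set.univ (fun _ => homPred σ K i)).map (mulVecK A)

/-- The dimension of the degree `i` cohomology of a matrix of linear forms of square zero. The
subtraction does not truncate, because the coboundaries are cocycles (`cobd_le_cocyc`). -/
noncomputable def matCohDim (A : Matrix r r (MvPolynomial σ K)) (i : ℕ) : ℕ :=
  Module.finrank K (cocyc A i) - Module.finrank K (cobd A i)

theorem mem_cocyc {A : Matrix r r (MvPolynomial σ K)} {i : ℕ} {z : r → MvPolynomial σ K} :
    z ∈ cocyc A i ↔ (∀ p, z p ∈ homogeneousSubmodule σ K i) ∧ A *ᵥ z = 0 := by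
  simp [cocyc, Submodule.mem_pi, mulVecK]

theorem mem_cobd {A : Matrix r r (MvPolynomial σ K)} {i : ℕ} {z : r → MvPolynomial σ K} :
    z ∈ cobd A i ↔ ∃ q : r → MvPolynomial σ K, (∀ p, q p ∈ homPred σ K i) ∧ A *ᵥ q = z := by
  simp [cobd, Submodule.mem_pi, mulVecK]

instance finite_pi_submodule {V : Type*} [AddCommGroup V] [Module K V] (p : r → Submodule K V)
    [∀ j, Module.Finite K (p j)] : Module.Finite K (Submodule.pi Set.univ p) := by
  refine Module.Finite.of_injective
    (LinearMap.pi fun j => ((LinearMap.proj j).domRestrict (Submodule.pi Set.univ p)).codRestrict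
      (p j) fun x => x.2 j trivial) ?_
  intro x y hxy
  ext j
  exact congrArg Subtype.val (congrFun hxy j)

instance [Finite σ] (A : Matrix r r (MvPolynomial σ K)) (i : ℕ) : Module.Finite K (cocyc A i) :=
  Submodule.finiteDimensional_of_le (inf_le_left :
    cocyc A i ≤ Submodule.pi Set.univ (fun _ => homogeneousSubmodule σ K i))

instance [Finite σ] (A : Matrix r r (MvPolynomial σ K)) (i : ℕ) : Module.Finite K (cobd A i) :=
  inferInstanceAs (Module.Finite K (Submodule.map _ _))

variable {A : Matrix r r (MvPolynomial σ K)}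

theorem cobd_le_cocyc (hA : ∀ p q, (A p q).IsHomogeneous 1) (hA2 : A * A = 0) (i : ℕ) :
    cobd A i ≤ cocyc A i := by
  intro z hz
  obtain ⟨q, hq, rfl⟩ := mem_cobd.1 hz
  refine mem_cocyc.2 ⟨fun p => ?_, ?_⟩
  · exact sum_mem fun m _ => mul_mem_of_mem_homPred (hA p m) (hq m)
  · rw [mulVec_mulVec, hA2, zero_mulVec]

section Homotopy

variable [DecidableEq r]

variable (A) in
/-- Pairs `(s, Φ)` of a form of degree `i` and a matrix of forms of degree `i - 1` such that
`s = A Φ + Φ A` holds in the columns that belong to `U`. -/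
noncomputable def homotopies (i : ℕ) (U : Finset r) :
    Submodule K (MvPolynomial σ K × Matrix r r (MvPolynomial σ K)) where
  carrier := {x | x.1 ∈ homogeneousSubmodule σ K i ∧ (∀ p l, x.2 p l ∈ homPred σ K i) ∧
    ∀ l ∈ U, ∀ p, (x.1 • (1 : Matrix r r (MvPolynomial σ K))) p l = (A * x.2 + x.2 * A) p l}
  add_mem' := by
    rintro x y ⟨h1, h2, h3⟩ ⟨h1', h2', h3'⟩
    refine ⟨add_mem h1 h1', fun p l => add_mem (h2 p l) (h2' p l), fun l hl p => ?_⟩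
    have e : A * (x + y).2 + (x + y).2 * A = (A * x.2 + x.2 * A) + (A * y.2 + y.2 * A) := by
      rw [Prod.snd_add, mul_add, add_mul]; abel
    rw [e, Matrix.add_apply, ← h3 l hl, ← h3' l hl, Prod.fst_add, add_smul, Matrix.add_apply]
  zero_mem' := ⟨zero_mem _, fun _ _ => zero_mem _, fun l _ p => by simp⟩
  smul_mem' := by
    rintro c x ⟨h1, h2, h3⟩
    refine ⟨Submodule.smul_mem _ c h1, fun p l => Submodule.smul_mem _ c (h2 p l),
      fun l hl p => ?_⟩
    have e : A * (c • x).2 + (c • x).2 * A = c • (A * x.2 + x.2 * A) := by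
      rw [Prod.smul_snd, mul_smul_comm, smul_mul_assoc, smul_add]
    rw [e, Prod.smul_fst, smul_assoc]
    exact congrArg (c • ·) (h3 l hl p)

variable (A) in
/-- The forms of degree `i` that admit a homotopy in the columns that belong to `U`. -/
noncomputable def homotopic (i : ℕ) (U : Finset r) : Submodule K (MvPolynomial σ K) :=
  (homotopies A i U).map (LinearMap.fst K _ _)

theorem homotopic_le (i : ℕ) (U : Finset r) : homotopic A i U ≤ homogeneousSubmodule σ K i := by
  rintro _ ⟨x, hx, rfl⟩
  exact hx.1

instance [Finite σ] (i : ℕ) (U : Finset r) : Module.Finite K (homotopic A i U) :=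
  Submodule.finiteDimensional_of_le (homotopic_le i U)

theorem homotopic_empty (i : ℕ) : homotopic A i ∅ = homogeneousSubmodule σ K i :=
  le_antisymm (homotopic_le i ∅) fun s hs =>
    ⟨(s, 0), ⟨hs, fun _ _ => zero_mem _, by simp⟩, rfl⟩

variable (A) in
/-- The obstruction to extending a homotopy to the column `k`. -/
noncomputable def obstruction (k : r) :
    MvPolynomial σ K × Matrix r r (MvPolynomial σ K) →ₗ[K] (r → MvPolynomial σ K) where
  toFun x p := (x.1 • (1 : Matrix r r (MvPolynomial σ K)) - x.2 * A) p k
  map_add' x y := by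
    ext1 p
    rw [Prod.snd_add, Prod.fst_add, add_mul, add_smul, add_sub_add_comm]
    rfl
  map_smul' c x := by
    ext1 p
    rw [Prod.smul_snd, Prod.smul_fst, smul_mul_assoc, smul_assoc, ← smul_sub]
    rfl

/-- Requiring a homotopy in one more column costs at most the dimension of the cohomology, because
the obstruction is a cocycle. Here `U` is closed under the arrows `l → m` with `A m l ≠ 0`, and all
arrows from `k` end in `U`, so that the columns of `A Φ + Φ A` that belong to `U` do not involve the
column `k` of `Φ`. -/
theorem finrank_homotopic_le [Finite σ] (hA : ∀ p q, (A p q).IsHomogeneous 1)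
    (hA2 : A * A = 0) (i : ℕ) (U : Finset r) (hU : ∀ l ∈ U, ∀ m, A m l ≠ 0 → m ∈ U) (k : r)
    (hk : k ∉ U)
    (hkU : ∀ m, A m k ≠ 0 → m ∈ U) :
    Module.finrank K (homotopic A i U) ≤
      Module.finrank K (homotopic A i (insert k U)) + matCohDim A i := by
  let p := (LinearMap.fst K (MvPolynomial σ K) (Matrix r r (MvPolynomial σ K))).domRestrict
    (homotopies A i U)
  let o := (obstruction A k).domRestrict (homotopies A i U)
  have hp : LinearMap.range p = homotopic A i U := LinearMap.range_domRestrict _ _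
  have : Module.Finite K (LinearMap.range p) := by rw [hp]; infer_instance
  have ho : ∀ x, o x ∈ cocyc A i := by
    rintro ⟨⟨s, Φ⟩, h1, h2, h3⟩
    simp only at h1 h2 h3
    refine mem_cocyc.2 ⟨fun q => ?_, ?_⟩
    · change (s • (1 : Matrix r r (MvPolynomial σ K)) - Φ * A) q k ∈ _
      rw [Matrix.sub_apply, Matrix.smul_apply, Matrix.one_apply, Matrix.mul_apply]
      refine sub_mem ?_ (sum_mem fun m _ => ?_)
      · split_ifs
        · simpa using h1
        · simp
      · rw [mul_comm]
        exact mul_mem_of_mem_homPred (hA m k) (h2 q m)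
    · funext q
      change (A * (s • (1 : Matrix r r (MvPolynomial σ K)) - Φ * A)) q k = 0
      have e1 : (A * (s • (1 : Matrix r r (MvPolynomial σ K)) - Φ * A)) =
          (s • (1 : Matrix r r (MvPolynomial σ K)) - (A * Φ + Φ * A)) * A := by
        rw [mul_sub, sub_mul, add_mul, mul_assoc Φ, hA2, mul_zero, add_zero, mul_smul_comm,
          mul_one, smul_mul_assoc, one_mul, mul_assoc]
      rw [e1, Matrix.mul_apply]
      refine Finset.sum_eq_zero fun m _ => ?_
      by_cases hm : A m k = 0
      · rw [hm, mul_zero]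
      · rw [Matrix.sub_apply, h3 m (hkU m hm), sub_self, zero_mul]
  have h := finrank_range_le_add p o (cocyc A i) (cobd A i) (cobd_le_cocyc hA hA2 i) ho
  rw [hp] at h
  refine h.trans (Nat.add_le_add_right (Submodule.finrank_mono ?_) _)
  rintro _ ⟨⟨⟨s, Φ⟩, h1, h2, h3⟩, hx, rfl⟩
  simp only at h1 h2 h3
  obtain ⟨q, hq, hqx⟩ := mem_cobd.1 (Submodule.mem_comap.1 hx)
  have hkk : A k k = 0 := by
    by_contra h
    exact hk (hkU k h)
  -- replace the column `k` of `Φ` by a preimage of the obstruction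
  refine ⟨(s, Φ.updateCol k q), ⟨h1, fun p l => ?_, fun l hl p => ?_⟩, rfl⟩
  · change Φ.updateCol k q p l ∈ _
    rw [Matrix.updateCol_apply]
    split_ifs
    · exact hq p
    · exact h2 p l
  · have hright : ∀ l, A k l = 0 → (Φ.updateCol k q * A) p l = (Φ * A) p l := by
      intro l hl
      rw [Matrix.mul_apply, Matrix.mul_apply]
      refine Finset.sum_congr rfl fun m _ => ?_
      by_cases hm : m = k
      · rw [hm, hl, mul_zero, mul_zero]
      · rw [Matrix.updateCol_ne hm]
    rcases Finset.mem_insert.1 hl with rfl | hl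
    · have e2 : (A * Φ.updateCol l q) p l = (A *ᵥ q) p := by
        rw [Matrix.mul_apply]
        refine Finset.sum_congr rfl fun m _ => ?_
        rw [Matrix.updateCol_self]
      rw [Matrix.add_apply, hright l hkk, e2, hqx]
      change _ = (s • (1 : Matrix r r (MvPolynomial σ K)) - Φ * A) p l + _
      rw [Matrix.sub_apply, sub_add_cancel]
    · have hlk : l ≠ k := fun e => hk (e ▸ hl)
      have hkl : A k l = 0 := by
        by_contra h
        exact hk (hU l hl k h)
      rw [Matrix.add_apply, hright l hkl, h3 l hl p, Matrix.add_apply, Matrix.mul_apply,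
        Matrix.mul_apply]
      congr 1
      refine Finset.sum_congr rfl fun m _ => ?_
      change A p m * Φ m l = A p m * Φ.updateCol k q m l
      rw [Matrix.updateCol_ne hlk]

/-- The forms `s` of degree `i` such that multiplication by `s` is null-homotopic have
codimension at most the size of the matrix times the dimension of the cohomology in degree `i`. -/
theorem finrank_homogeneous_le [Finite σ] (hA : ∀ p q, (A p q).IsHomogeneous 1) (hA2 : A * A = 0)
    (ht : r → ℤ) (hht : ∀ m l, A m l ≠ 0 → ht l < ht m) (i : ℕ) :
    Module.finrank K (homogeneousSubmodule σ K i) ≤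
      Module.finrank K (homotopic A i Finset.univ) + Fintype.card r * matCohDim A i := by
  have key : ∀ c ≤ Fintype.card r, ∃ U : Finset r, U.card = c ∧
      (∀ l ∈ U, ∀ m, A m l ≠ 0 → m ∈ U) ∧ Module.finrank K (homogeneousSubmodule σ K i) ≤
        Module.finrank K (homotopic A i U) + c * matCohDim A i := by
    intro c hc
    induction c with
    | zero => exact ⟨∅, rfl, by simp, by rw [homotopic_empty]; simp⟩
    | succ c ih =>
      obtain ⟨U, hUc, hU, hle⟩ := ih (by omega)
      have hne : (Uᶜ).Nonempty := by
        rw [← Finset.card_pos, Finset.card_compl]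
        omega
      -- `A` raises heights, so the next column is one of maximal height among those left
      obtain ⟨k, hk, hmax⟩ := Finset.exists_max_image Uᶜ ht hne
      rw [Finset.mem_compl] at hk
      have hkU : ∀ m, A m k ≠ 0 → m ∈ U := by
        intro m hm
        by_contra hmU
        exact absurd (hht m k hm) (not_lt.2 (hmax m (Finset.mem_compl.2 hmU)))
      refine ⟨insert k U, by rw [Finset.card_insert_of_notMem hk, hUc], ?_, ?_⟩
      · intro l hl m hm
        rcases Finset.mem_insert.1 hl with rfl | hl
        · exact Finset.mem_insert_of_mem (hkU m hm)
        · exact Finset.mem_insert_of_mem (hU l hl m hm)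
      · have := finrank_homotopic_le hA hA2 i U hU k hk hkU
        rw [add_mul, one_mul]
        omega
  obtain ⟨U, hUc, -, hle⟩ := key _ le_rfl
  rwa [Finset.card_eq_iff_eq_univ _ |>.1 hUc] at hle

end Homotopy

/-- The kernel of a matrix of linear forms is generated by finitely many homogeneous vectors. -/
theorem exists_generators [Finite σ] (hA : ∀ p q, (A p q).IsHomogeneous 1) :
    ∃ (N : ℕ) (a : Fin N → ℕ) (g : Fin N → r → MvPolynomial σ K), (∀ k, g k ∈ cocyc A (a k)) ∧
      ∀ i, ∀ z ∈ cocyc A i, ∃ s : Fin N → MvPolynomial σ K,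
        (∀ k, a k ≤ i → s k ∈ homogeneousSubmodule σ K (i - a k)) ∧ (∀ k, ¬ a k ≤ i → s k = 0) ∧
          z = ∑ k, s k • g k := by
  -- the homogeneous components of finitely many generators lie in the kernel and generate it
  obtain ⟨S, hS⟩ := (IsNoetherian.noetherian (LinearMap.ker A.mulVecLin) :
    (LinearMap.ker A.mulVecLin).FG)
  let comp : ℕ → (r → MvPolynomial σ K) → r → MvPolynomial σ K :=
    fun i z p => homogeneousComponent i (z p)
  have hcomp : ∀ i z, A *ᵥ z = 0 → comp i z ∈ cocyc A i := by
    intro i z hz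
    refine mem_cocyc.2 ⟨fun p => homogeneousComponent_mem _ _, ?_⟩
    funext p
    have h := congrArg (homogeneousComponent (i + 1)) (congrFun hz p)
    rw [Pi.zero_apply, map_zero] at h
    rw [Pi.zero_apply, ← h]
    change ∑ q, A p q * comp i z q = homogeneousComponent (i + 1) (∑ q, A p q * z q)
    rw [map_sum]
    refine Finset.sum_congr rfl fun q _ => ?_
    rw [mul_comm, mul_comm _ (z q), homogeneousComponent_mul_of_isHomogeneous (hA p q),
      if_pos (by omega), Nat.add_sub_cancel]
  obtain ⟨D, hD⟩ : ∃ D, ∀ z ∈ S, ∀ p, (z p).totalDegree < D := by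
    refine ⟨(S.sup fun z => Finset.univ.sup fun p => (z p).totalDegree) + 1, fun z hz p => ?_⟩
    rw [Nat.lt_succ_iff]
    exact (Finset.le_sup (f := fun p => (z p).totalDegree) (Finset.mem_univ p)).trans
      (Finset.le_sup (f := fun z : r → MvPolynomial σ K =>
        Finset.univ.sup fun p => (z p).totalDegree) hz)
  have hsum : ∀ z ∈ S, z = ∑ d : Fin D, comp d z := by
    intro z hz
    funext p
    rw [Finset.sum_apply, Fin.sum_univ_eq_sum_range (fun d => comp d z p)]
    conv_lhs => rw [← sum_homogeneousComponent (z p)]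
    refine Finset.sum_subset (fun d hd => ?_) fun d _ hd => ?_
    · have := hD z hz p
      rw [Finset.mem_range] at hd ⊢
      omega
    · exact homogeneousComponent_eq_zero _ _ (by simpa using hd)
  have hSker : ∀ z ∈ S, A *ᵥ z = 0 := by
    intro z hz
    have : z ∈ LinearMap.ker A.mulVecLin := by
      rw [← hS]
      exact Submodule.subset_span hz
    exact this
  let e := Fintype.equivFin (S × Fin D)
  refine ⟨_, fun k => (e.symm k).2, fun k => comp (e.symm k).2 (e.symm k).1,
    fun k => hcomp _ _ (hSker _ (e.symm k).1.2), fun i z hz => ?_⟩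
  obtain ⟨hz1, hz2⟩ := mem_cocyc.1 hz
  have hzS : z ∈ Submodule.span (MvPolynomial σ K) (S : Set (r → MvPolynomial σ K)) := by
    rw [hS]
    exact hz2
  obtain ⟨c, hc⟩ := Submodule.mem_span_finset'.1 hzS
  refine ⟨fun k => if ((e.symm k).2 : ℕ) ≤ i then
    homogeneousComponent (i - (e.symm k).2) (c (e.symm k).1) else 0, fun k hk => ?_,
    fun k hk => if_neg hk, ?_⟩
  · simp only
    rw [if_pos hk]
    exact homogeneousComponent_mem _ _
  · rw [e.symm.sum_comp (fun x : S × Fin D => (if (x.2 : ℕ) ≤ i then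
      homogeneousComponent (i - x.2) (c x.1) else 0) • comp x.2 x.1)]
    funext p
    have hzp : homogeneousComponent i (z p) = z p := homogeneousComponent_eq_self (hz1 p)
    rw [← hzp, ← hc, Finset.sum_apply, Finset.sum_apply, map_sum, Fintype.sum_prod_type]
    refine Finset.sum_congr rfl fun x _ => ?_
    have hx := congrFun (hsum x.1 x.2) p
    rw [Pi.smul_apply, smul_eq_mul, hx, Finset.sum_apply, Finset.mul_sum, map_sum]
    refine Finset.sum_congr rfl fun d _ => ?_
    rw [homogeneousComponent_mul_of_isHomogeneous (homogeneousComponent_isHomogeneous _ _)]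
    simp only [Pi.smul_apply, smul_eq_mul, ite_mul, zero_mul]
    rfl

variable [DecidableEq r]

/-- Multiplication by a null-homotopic form kills the cohomology of the transposed matrix. -/
theorem smul_mem_cobd_transpose {a j : ℕ} {s : MvPolynomial σ K} {g : r → MvPolynomial σ K}
    (hs : s ∈ homotopic A j Finset.univ) (hg : g ∈ cocyc Aᵀ a) : s • g ∈ cobd Aᵀ (a + j) := by
  obtain ⟨⟨s, Φ⟩, ⟨h1, h2, h3⟩, rfl⟩ := hs
  simp only at h1 h2 h3
  obtain ⟨hg1, hg2⟩ := mem_cocyc.1 hg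
  rw [mulVec_transpose] at hg2
  refine mem_cobd.2 ⟨g ᵥ* Φ, fun p => sum_mem fun m _ => mul_mem_homPred (hg1 m) (h2 m p), ?_⟩
  have e : s • (1 : Matrix r r (MvPolynomial σ K)) = A * Φ + Φ * A := by
    ext1 p l
    exact h3 l (Finset.mem_univ l) p
  have e2 : g ᵥ* (s • (1 : Matrix r r (MvPolynomial σ K))) = s • g := by
    rw [vecMul_smul, vecMul_one]
  rw [mulVec_transpose, vecMul_vecMul]
  change _ = s • g
  rw [← e2, e, vecMul_add, ← vecMul_vecMul g A, hg2, zero_vecMul, zero_add]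

/-- Up to finitely many shifts and a constant, the cohomology of the transpose of a triangular
matrix of linear forms is bounded by the cohomology of the matrix. The shifts `a_k` are the degrees
of generators of the kernel of the transpose; modulo coboundaries, the coefficients of the generators
may be taken in complements of the spaces of null-homotopic forms. -/
theorem exists_matCohDim_transpose_le [Finite σ] (hA : ∀ p q, (A p q).IsHomogeneous 1)
    (hA2 : A * A = 0) (ht : r → ℤ) (hht : ∀ m l, A m l ≠ 0 → ht l < ht m) :
    ∃ (N : ℕ) (a : Fin N → ℕ), ∀ i, matCohDim Aᵀ i ≤
      ∑ k, if a k ≤ i then Fintype.card r * matCohDim A (i - a k) else 0 := by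
  obtain ⟨N, a, g, hg, hgen⟩ := exists_generators (A := Aᵀ) fun p q => hA q p
  refine ⟨N, a, fun i => ?_⟩
  have hT : ∀ j, ∃ T : Submodule K (MvPolynomial σ K),
      homogeneousSubmodule σ K j = homotopic A j Finset.univ ⊔ T ∧ T ≤ homogeneousSubmodule σ K j ∧
        Module.finrank K T ≤ Fintype.card r * matCohDim A j := by
    intro j
    have h := homotopic_le (A := A) j Finset.univ
    obtain ⟨T, hT1, hT2⟩ := IsModularLattice.exists_disjoint_and_sup_eq h
    have hTle : T ≤ homogeneousSubmodule σ K j := by rw [← hT2]; exact le_sup_right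
    have : Module.Finite K T := Submodule.finiteDimensional_of_le hTle
    refine ⟨T, hT2.symm, hTle, ?_⟩
    have h1 := Submodule.finrank_sup_add_finrank_inf_eq (homotopic A j Finset.univ) T
    rw [hT1.eq_bot, finrank_bot, hT2] at h1
    have := finrank_homogeneous_le hA hA2 ht hht j
    omega
  choose T hT1 hT2 hT3 using hT
  have hTfin : ∀ j, Module.Finite K (T j) := fun j => Submodule.finiteDimensional_of_le (hT2 j)
  let T' : Fin N → Submodule K (MvPolynomial σ K) := fun k => if a k ≤ i then T (i - a k) else ⊥
  have hT'1 : ∀ k, a k ≤ i → T' k = T (i - a k) := fun k hk => if_pos hk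
  have hT'2 : ∀ k, ¬ a k ≤ i → T' k = ⊥ := fun k hk => if_neg hk
  have hT'fin : ∀ k, Module.Finite K (T' k) := by
    intro k
    by_cases hk : a k ≤ i
    · rw [hT'1 k hk]; exact hTfin _
    · rw [hT'2 k hk]; infer_instance
  let ψ : (∀ k, T' k) →ₗ[K] (r → MvPolynomial σ K) :=
    { toFun := fun t => ∑ k, (t k : MvPolynomial σ K) • g k
      map_add' := fun t t' => by
        simp only [Pi.add_apply, Submodule.coe_add, add_smul, Finset.sum_add_distrib]
      map_smul' := fun c t => by
        simp only [Pi.smul_apply, Submodule.coe_smul, smul_assoc, Finset.smul_sum,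
          RingHom.id_apply] }
  have hle : cocyc Aᵀ i ≤ cobd Aᵀ i ⊔ LinearMap.range ψ := by
    intro z hz
    obtain ⟨s, hs1, hs2, rfl⟩ := hgen i z hz
    have hst : ∀ k, ∃ t : T' k, (s k - t) • g k ∈ cobd Aᵀ i := by
      intro k
      by_cases hk : a k ≤ i
      · have h := hs1 k hk
        rw [hT1] at h
        obtain ⟨y, hy, t, htT, hyt⟩ := Submodule.mem_sup.1 h
        refine ⟨⟨t, by rw [hT'1 k hk]; exact htT⟩, ?_⟩
        rw [← hyt, add_sub_cancel_right]
        have := smul_mem_cobd_transpose hy (hg k)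
        rwa [Nat.add_sub_cancel' hk] at this
      · refine ⟨0, ?_⟩
        rw [hs2 k hk]
        simp
    choose t ht' using hst
    have : ∑ k, s k • g k = ∑ k, (s k - t k) • g k + ψ t := by
      change _ = _ + ∑ k, (t k : MvPolynomial σ K) • g k
      rw [← Finset.sum_add_distrib]
      refine Finset.sum_congr rfl fun k _ => ?_
      rw [← add_smul, sub_add_cancel]
    rw [this]
    exact Submodule.add_mem_sup (sum_mem fun k _ => ht' k) ⟨t, rfl⟩
  have h1 := (Submodule.finrank_mono hle).trans
    (Submodule.finrank_add_le_finrank_add_finrank (cobd Aᵀ i) (LinearMap.range ψ))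
  have h2 := LinearMap.finrank_range_le ψ
  rw [Module.finrank_pi_fintype] at h2
  have h3 : ∑ k, Module.finrank K (T' k) ≤
      ∑ k, if a k ≤ i then Fintype.card r * matCohDim A (i - a k) else 0 := by
    refine Finset.sum_le_sum fun k _ => ?_
    by_cases hk : a k ≤ i
    · rw [if_pos hk, hT'1 k hk]
      exact hT3 _
    · rw [if_neg hk, hT'2 k hk, finrank_bot]
  rw [matCohDim]
  omega

end MatrixComplex

/-! ### Cartan homology -/

section Quotients

variable {K : Type*} [Field K] {V V' W : Type*} [AddCommGroup V] [Module K V] [AddCommGroup V']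
  [Module K V'] [AddCommGroup W] [Module K W]

/-- The dimension of the subquotient `Z / B`. -/
noncomputable def quotDim (Z B : Submodule K V) : ℕ := Module.finrank K (Z ⧸ B.submoduleOf Z)

theorem quotDim_eq_of_surjective (Z B : Submodule K V) (φ : W →ₗ[K] V) (hφ : ∀ w, φ w ∈ Z)
    (hZ : ∀ z ∈ Z, ∃ w, φ w = z) :
    quotDim Z B = Module.finrank K (W ⧸ B.comap φ) := by
  let f : W →ₗ[K] (Z ⧸ B.submoduleOf Z) := (B.submoduleOf Z).mkQ ∘ₗ φ.codRestrict Z hφ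
  have hf : Function.Surjective f := by
    refine (Submodule.mkQ_surjective _).comp fun ⟨z, hz⟩ => ?_
    obtain ⟨w, hw⟩ := hZ z hz
    exact ⟨w, Subtype.ext hw⟩
  have hk : LinearMap.ker f = B.comap φ := by
    rw [LinearMap.ker_comp, Submodule.ker_mkQ]
    rfl
  rw [quotDim, ← hk, (f.quotKerEquivOfSurjective hf).finrank_eq]

/-- Two subquotients have the same dimension if they are images of one space under maps with the
same kernel. -/
theorem quotDim_eq_quotDim (Z B : Submodule K V) (Z' B' : Submodule K V')
    (φ : W →ₗ[K] V) (ψ : W →ₗ[K] V') (hφ : ∀ w, φ w ∈ Z) (hZ : ∀ z ∈ Z, ∃ w, φ w = z)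
    (hψ : ∀ w, ψ w ∈ Z') (hZ' : ∀ z ∈ Z', ∃ w, ψ w = z) (h : ∀ w, φ w ∈ B ↔ ψ w ∈ B') :
    quotDim Z B = quotDim Z' B' := by
  rw [quotDim_eq_of_surjective Z B φ hφ hZ, quotDim_eq_of_surjective Z' B' ψ hψ hZ',
    show B.comap φ = B'.comap ψ from Submodule.ext h]

end Quotients

section Cartan

variable {K : Type*} [Field K] {n : ℕ} {X : Type*} [AddCommGroup X] [Module K X]

/-- The differential `(∂f)(α) = ∑_j e_j f(α + δ_j)` of the Cartan complex of a space with `n`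
operators. A function `f` stands for the element `∑_α x^{(α)} ⊗ f(α)` of (the completion of) the
tensor product with the divided power algebra on `n` variables. -/
noncomputable def cartanD (e : Fin n → Module.End K X) :
    ((Fin n →₀ ℕ) → X) →ₗ[K] ((Fin n →₀ ℕ) → X) where
  toFun f α := ∑ j, e j (f (α + Finsupp.single j 1))
  map_add' f g := by
    ext α
    simp [Finset.sum_add_distrib]
  map_smul' c f := by
    ext α
    simp [Finset.smul_sum]

theorem cartanD_apply (e : Fin n → Module.End K X) (f : (Fin n →₀ ℕ) → X) (α : Fin n →₀ ℕ) :
    cartanD e f α = ∑ j, e j (f (α + Finsupp.single j 1)) := rfl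

variable (K X n) in
/-- The elements of degree `i` of the Cartan complex. -/
def degFun (i : ℕ) : Submodule K ((Fin n →₀ ℕ) → X) where
  carrier := {f | ∀ α, α.degree ≠ i → f α = 0}
  add_mem' hf hg α hα := by rw [Pi.add_apply, hf α hα, hg α hα, add_zero]
  zero_mem' _ _ := rfl
  smul_mem' c f hf α hα := by rw [Pi.smul_apply, hf α hα, smul_zero]

theorem degree_add_single (α : Fin n →₀ ℕ) (j : Fin n) :
    (α + Finsupp.single j 1).degree = α.degree + 1 := by
  rw [map_add, Finsupp.degree_single]

theorem cartanD_mem_degFun (e : Fin n → Module.End K X) {i : ℕ} {f : (Fin n →₀ ℕ) → X}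
    (hf : f ∈ degFun K n X (i + 1)) : cartanD e f ∈ degFun K n X i := by
  intro α hα
  rw [cartanD_apply]
  refine Finset.sum_eq_zero fun j _ => ?_
  rw [hf _ (by rw [degree_add_single]; omega), map_zero]

theorem cartanD_cartanD {e : Fin n → Module.End K X} (he : Anticommute e) (f : (Fin n →₀ ℕ) → X) :
    cartanD e (cartanD e f) = 0 := by
  funext α
  simp only [cartanD_apply, map_sum, Pi.zero_apply]
  rw [← Finset.sum_product']
  -- the terms of `(j, k)` and `(k, j)` cancel, and those of `(j, j)` vanish
  refine Finset.sum_involution (fun x _ => x.swap) ?_ ?_ (fun x _ => Finset.mem_univ _)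
    fun x _ => Prod.swap_swap x
  · rintro ⟨j, k⟩ _
    have := LinearMap.congr_fun (he.swap j k)
      (f (α + Finsupp.single j 1 + Finsupp.single k 1))
    simp only [Module.End.mul_apply, LinearMap.neg_apply] at this
    simp only [Prod.swap_prod_mk]
    rw [this, add_right_comm, neg_add_cancel]
  · rintro ⟨j, k⟩ _ h h'
    have : k = j := congrArg Prod.fst h'
    subst this
    exact h (LinearMap.congr_fun (he.sq k) _)

/-- The cycles of degree `i` of the Cartan complex. -/
noncomputable def cartanZ (e : Fin n → Module.End K X) (i : ℕ) : Submodule K ((Fin n →₀ ℕ) → X) :=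
  degFun K n X i ⊓ LinearMap.ker (cartanD e)

/-- The boundaries of degree `i` of the Cartan complex. -/
noncomputable def cartanB (e : Fin n → Module.End K X) (i : ℕ) : Submodule K ((Fin n →₀ ℕ) → X) :=
  (degFun K n X (i + 1)).map (cartanD e)

/-- The dimension of the degree `i` Cartan homology. -/
noncomputable def cartanDim (e : Fin n → Module.End K X) (i : ℕ) : ℕ :=
  quotDim (cartanZ e i) (cartanB e i)

/-- If the operators `e_j` have adjoint contractions `c_j`, then the Cartan complex is acyclic in
positive degrees. Indeed `f ↦ (α ↦ c_j f(α - δ_j))` is a homotopy from the identity to a map whose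
values vanish at all `α` with `α_j > 0`; use these homotopies for all `j` in turn. -/
theorem mem_cartanB_of_contraction {e : Fin n → Module.End K X} (he : Anticommute e)
    (c : Fin n → X →+ X)
    (hc : ∀ j k x, c j (e k x) = (if j = k then x else 0) - e k (c j x)) {i : ℕ} (hi : 1 ≤ i)
    {f : (Fin n →₀ ℕ) → X} (hf : f ∈ cartanZ e i) : f ∈ cartanB e i := by
  have step : ∀ (j : Fin n) (f : (Fin n →₀ ℕ) → X), f ∈ cartanZ e i → ∃ g ∈ degFun K n X (i + 1),
      ∀ α, cartanD e g α = if α j = 0 then e j (c j (f α)) else f α := by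
    intro j f hf
    refine ⟨fun α => if α j = 0 then 0 else c j (f (α - Finsupp.single j 1)), fun α hα => ?_,
      fun α => ?_⟩
    · by_cases h : α j = 0
      · exact if_pos h
      · refine (if_neg h).trans ?_
        have hα' : α - Finsupp.single j 1 + Finsupp.single j 1 = α :=
          tsub_add_cancel_of_le (by rw [Finsupp.single_le_iff]; omega)
        have := degree_add_single (α - Finsupp.single j 1) j
        rw [hα'] at this
        rw [hf.1 _ (by omega), map_zero]
    · rw [cartanD_apply]
      by_cases hα : α j = 0
      · rw [if_pos hα, Finset.sum_eq_single j]
        · rw [if_neg (by simp), add_tsub_cancel_right]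
        · intro k _ hk
          rw [if_pos (by simp [hα, Finsupp.single_eq_of_ne hk.symm]), map_zero]
        · simp
      · obtain ⟨β, rfl⟩ : ∃ β, α = β + Finsupp.single j 1 :=
          ⟨α - Finsupp.single j 1, (tsub_add_cancel_of_le
            (by rw [Finsupp.single_le_iff]; omega)).symm⟩
        have h0 : c j (cartanD e f β) = 0 := by
          rw [show cartanD e f = 0 from hf.2, Pi.zero_apply, map_zero]
        simp only [cartanD_apply, map_sum, hc, Finset.sum_sub_distrib, Finset.sum_ite_eq,
          Finset.mem_univ, if_true] at h0
        rw [if_neg hα, sub_eq_zero.1 h0]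
        refine Finset.sum_congr rfl fun k _ => ?_
        rw [if_neg (by simp), add_right_comm, add_tsub_cancel_right]
  have key : ∀ l : List (Fin n), ∃ f' ∈ cartanZ e i, f - f' ∈ cartanB e i ∧
      ∀ α, f' α ≠ 0 → ∀ j ∈ l, α j = 0 := by
    intro l
    induction l with
    | nil => exact ⟨f, hf, by simp, by simp⟩
    | cons j l ih =>
      obtain ⟨f', hf', hff', hl⟩ := ih
      obtain ⟨g, hg, hgα⟩ := step j f' hf'
      have hval : ∀ α, (f' - cartanD e g) α =
          if α j = 0 then f' α - e j (c j (f' α)) else 0 := by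
        intro α
        rw [Pi.sub_apply, hgα]
        split_ifs
        · rfl
        · rw [sub_self]
      refine ⟨f' - cartanD e g, sub_mem hf' ⟨cartanD_mem_degFun e hg, cartanD_cartanD he g⟩, ?_, ?_⟩
      · rw [← sub_add]
        exact add_mem hff' ⟨g, hg, rfl⟩
      · intro α hα k hk
        rw [hval] at hα
        split_ifs at hα with h
        · rcases List.mem_cons.1 hk with rfl | hk
          · exact h
          · refine hl α (fun h0 => hα ?_) k hk
            rw [h0, map_zero, map_zero, sub_zero]
        · exact absurd rfl hα
  obtain ⟨f', hf', hff', hl⟩ := key (List.finRange n)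
  have : f' = 0 := by
    funext α
    by_contra hα
    have h0 : α = 0 := Finsupp.ext fun j => hl α hα j (List.mem_finRange j)
    subst h0
    exact hα (hf'.1 0 (by rw [map_zero]; omega))
  rwa [this, sub_zero] at hff'

theorem cartanB_le_cartanZ {e : Fin n → Module.End K X} (he : Anticommute e) (i : ℕ) :
    cartanB e i ≤ cartanZ e i := by
  rintro _ ⟨g, hg, rfl⟩
  exact ⟨cartanD_mem_degFun e hg, cartanD_cartanD he g⟩

theorem exists_degFun_one (y : Fin n → X) :
    ∃ f ∈ degFun K n X 1, ∀ j, f (Finsupp.single j 1) = y j := by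
  classical
  refine ⟨fun α => ∑ j, if α = Finsupp.single j 1 then y j else 0, fun α hα => ?_, fun j => ?_⟩
  · refine Finset.sum_eq_zero fun j _ => if_neg ?_
    rintro rfl
    exact hα (Finsupp.degree_single j 1)
  · simp [Finsupp.single_left_inj]

section Functoriality

variable {Y : Type*} [AddCommGroup Y] [Module K Y] {e : Fin n → Module.End K X}
  {e' : Fin n → Module.End K Y}

/-- The map of Cartan complexes induced by a linear map. -/
def cartanMap (n : ℕ) (p : X →ₗ[K] Y) : ((Fin n →₀ ℕ) → X) →ₗ[K] ((Fin n →₀ ℕ) → Y) :=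
  p.compLeft (Fin n →₀ ℕ)

theorem cartanMap_apply (p : X →ₗ[K] Y) (f : (Fin n →₀ ℕ) → X) (α : Fin n →₀ ℕ) :
    cartanMap n p f α = p (f α) := rfl

theorem cartanD_cartanMap (p : X →ₗ[K] Y) (hp : ∀ j x, p (e j x) = e' j (p x))
    (f : (Fin n →₀ ℕ) → X) : cartanD e' (cartanMap n p f) = cartanMap n p (cartanD e f) := by
  funext α
  simp only [cartanD_apply, cartanMap_apply, map_sum, hp]

theorem cartanMap_mem_degFun (p : X →ₗ[K] Y) {i : ℕ} {f : (Fin n →₀ ℕ) → X}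
    (hf : f ∈ degFun K n X i) : cartanMap n p f ∈ degFun K n Y i := fun α hα => by
  rw [cartanMap_apply, hf α hα, map_zero]

theorem exists_cartanMap_eq (p : X →ₗ[K] Y) {i : ℕ} {f : (Fin n →₀ ℕ) → Y}
    (hf : f ∈ degFun K n Y i) (h : ∀ α, f α ∈ LinearMap.range p) :
    ∃ g ∈ degFun K n X i, cartanMap n p g = f := by
  classical
  choose g hg using h
  refine ⟨fun α => if α.degree = i then g α else 0, fun α hα => if_neg hα, ?_⟩
  funext α
  rw [cartanMap_apply]
  split_ifs with h
  · exact hg α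
  · rw [map_zero, hf α h]

theorem cartanDim_eq_of_equiv (p : X ≃ₗ[K] Y) (hp : ∀ j x, p (e j x) = e' j (p x)) (i : ℕ) :
    cartanDim e i = cartanDim e' i := by
  have hp' : ∀ j y, p.symm (e' j y) = e j (p.symm y) := fun j y => by
    rw [LinearEquiv.symm_apply_eq, hp, LinearEquiv.apply_symm_apply]
  have h1 : ∀ f, cartanMap n (p.symm : Y →ₗ[K] X) (cartanMap n (p : X →ₗ[K] Y) f) = f := fun f =>
    funext fun α => p.symm_apply_apply (f α)
  have h2 : ∀ f, cartanMap n (p : X →ₗ[K] Y) (cartanMap n (p.symm : Y →ₗ[K] X) f) = f := fun f =>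
    funext fun α => p.apply_symm_apply (f α)
  have hz : ∀ f ∈ cartanZ e i, cartanMap n (p : X →ₗ[K] Y) f ∈ cartanZ e' i := fun f hf =>
    ⟨cartanMap_mem_degFun _ hf.1, by
      rw [SetLike.mem_coe, LinearMap.mem_ker, cartanD_cartanMap (e := e) _ hp,
        show cartanD e f = 0 from hf.2, map_zero]⟩
  have hz' : ∀ f ∈ cartanZ e' i, cartanMap n (p.symm : Y →ₗ[K] X) f ∈ cartanZ e i := fun f hf =>
    ⟨cartanMap_mem_degFun _ hf.1, by
      rw [SetLike.mem_coe, LinearMap.mem_ker, cartanD_cartanMap (e := e') _ hp',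
        show cartanD e' f = 0 from hf.2, map_zero]⟩
  refine quotDim_eq_quotDim _ _ _ _ (cartanZ e i).subtype
    (cartanMap n (p : X →ₗ[K] Y) ∘ₗ (cartanZ e i).subtype) (fun w => w.2)
    (fun z hz => ⟨⟨z, hz⟩, rfl⟩) (fun w => hz _ w.2)
    (fun z hz => ⟨⟨_, hz' z hz⟩, h2 z⟩) fun w => ⟨?_, ?_⟩
  · rintro ⟨g, hg, hgw⟩
    refine ⟨_, cartanMap_mem_degFun (p : X →ₗ[K] Y) hg, ?_⟩
    rw [cartanD_cartanMap (e := e) _ hp, hgw]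
    rfl
  · rintro ⟨g, hg, hgw⟩
    refine ⟨_, cartanMap_mem_degFun (p.symm : Y →ₗ[K] X) hg, ?_⟩
    rw [cartanD_cartanMap (e := e') _ hp', hgw]
    exact h1 _

variable {P : Type*} [AddCommGroup P] [Module K P] {eP : Fin n → Module.End K P}

/-- Dimension shifting along a short exact sequence `0 → X → P → Y → 0` with acyclic middle
term. -/
theorem cartanDim_succ_eq (heP : Anticommute eP) (ι : X →ₗ[K] P)
    (π : P →ₗ[K] Y) (hι : ∀ j x, ι (e j x) = eP j (ι x)) (hπ : ∀ j x, π (eP j x) = e' j (π x))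
    (hinj : Function.Injective ι) (hex : ∀ x, π x = 0 ↔ x ∈ LinearMap.range ι)
    (hsurj : Function.Surjective π) (hac : ∀ i, 1 ≤ i → cartanZ eP i ≤ cartanB eP i)
    {i : ℕ} (hi : 1 ≤ i) : cartanDim e' (i + 1) = cartanDim e i := by
  have hπι : ∀ f, cartanMap n π (cartanMap n ι f) = 0 := fun f =>
    funext fun α => (hex _).2 ⟨f α, rfl⟩
  have hker : ∀ f, cartanMap n π f = 0 → ∀ α, f α ∈ LinearMap.range ι := fun f hf α =>
    (hex _).1 (congrFun hf α)
  have hinj' : Function.Injective (cartanMap n ι) := fun f g hfg =>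
    funext fun α => hinj (congrFun hfg α)
  -- pairs of `g` of degree `i + 1` over `P` and `q` of degree `i` over `X` with `∂g = q`
  let W : Submodule K (((Fin n →₀ ℕ) → P) × ((Fin n →₀ ℕ) → X)) :=
    (degFun K n P (i + 1)).prod (degFun K n X i) ⊓
      LinearMap.eqLocus (cartanD eP ∘ₗ LinearMap.fst K _ _) (cartanMap n ι ∘ₗ LinearMap.snd K _ _)
  have hW : ∀ w : W, w.1.1 ∈ degFun K n P (i + 1) ∧ w.1.2 ∈ degFun K n X i ∧
      cartanD eP w.1.1 = cartanMap n ι w.1.2 := fun w => ⟨w.2.1.1, w.2.1.2, w.2.2⟩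
  have hWmk : ∀ g ∈ degFun K n P (i + 1), ∀ q ∈ degFun K n X i,
      cartanD eP g = cartanMap n ι q → ∃ w : W, w.1 = (g, q) := fun g hg q hq h =>
    ⟨⟨(g, q), ⟨hg, hq⟩, h⟩, rfl⟩
  refine quotDim_eq_quotDim _ _ _ _ (cartanMap n π ∘ₗ LinearMap.fst K _ _ ∘ₗ W.subtype)
    (LinearMap.snd K _ _ ∘ₗ W.subtype) (fun w => ?_) (fun f hf => ?_) (fun w => ?_)
    (fun q hq => ?_) fun w => ?_
  · obtain ⟨h1, h2, h3⟩ := hW w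
    refine ⟨cartanMap_mem_degFun _ h1, ?_⟩
    change cartanD e' (cartanMap n π w.1.1) = 0
    rw [cartanD_cartanMap (e := eP) _ hπ, h3, hπι]
  · obtain ⟨g, hg, rfl⟩ := exists_cartanMap_eq π hf.1 fun α => hsurj (f α)
    have h0 : cartanMap n π (cartanD eP g) = 0 := by
      rw [← cartanD_cartanMap (e' := e') _ hπ]
      exact hf.2
    obtain ⟨q, hq, hqg⟩ := exists_cartanMap_eq ι (cartanD_mem_degFun eP hg) (hker _ h0)
    obtain ⟨w, hw⟩ := hWmk g hg q hq hqg.symm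
    exact ⟨w, congrArg (fun x => cartanMap n π x.1) hw⟩
  · obtain ⟨h1, h2, h3⟩ := hW w
    refine ⟨h2, hinj' ?_⟩
    change cartanMap n ι (cartanD e w.1.2) = _
    rw [← cartanD_cartanMap (e' := eP) _ hι, ← h3, cartanD_cartanD heP, map_zero]
  · have hz : cartanMap n ι q ∈ cartanZ eP i := by
      refine ⟨cartanMap_mem_degFun _ hq.1, ?_⟩
      rw [SetLike.mem_coe, LinearMap.mem_ker, cartanD_cartanMap (e := e) _ hι,
        show cartanD e q = 0 from hq.2, map_zero]
    obtain ⟨g, hg, hgq⟩ := hac i hi hz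
    obtain ⟨w, hw⟩ := hWmk g hg q hq.1 hgq
    exact ⟨w, congrArg Prod.snd hw⟩
  · obtain ⟨h1, h2, h3⟩ := hW w
    change cartanMap n π w.1.1 ∈ cartanB e' (i + 1) ↔ w.1.2 ∈ cartanB e i
    constructor
    · rintro ⟨f, hf, hfw⟩
      obtain ⟨g, hg, rfl⟩ := exists_cartanMap_eq π hf fun α => hsurj (f α)
      rw [cartanD_cartanMap (e := eP) _ hπ] at hfw
      have h0 : cartanMap n π (w.1.1 - cartanD eP g) = 0 := by rw [map_sub, hfw, sub_self]
      obtain ⟨q, hq, hqg⟩ := exists_cartanMap_eq ι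
        (sub_mem h1 (cartanD_mem_degFun eP hg)) (hker _ h0)
      refine ⟨q, hq, hinj' ?_⟩
      rw [← cartanD_cartanMap (e' := eP) _ hι, hqg, map_sub, cartanD_cartanD heP, sub_zero, h3]
    · rintro ⟨q, hq, hqw⟩
      have hz : w.1.1 - cartanMap n ι q ∈ cartanZ eP (i + 1) := by
        refine ⟨sub_mem h1 (cartanMap_mem_degFun _ hq), ?_⟩
        rw [SetLike.mem_coe, LinearMap.mem_ker, map_sub, cartanD_cartanMap (e := e) _ hι, hqw, h3,
          sub_self]
      obtain ⟨g, hg, hgw⟩ := hac (i + 1) (by omega) hz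
      refine ⟨cartanMap n π g, cartanMap_mem_degFun _ hg, ?_⟩
      rw [cartanD_cartanMap (e := eP) _ hπ, hgw, map_sub, hπι, sub_zero]

end Functoriality

end Cartan

section ExteriorModules

variable {K : Type u} [Field K] {n : ℕ} {X : Type*} [AddCommGroup X] [Module (E K n) X]

/-- The submodule `𝔪 X` is `e_1 X + ⋯ + e_n X`. -/
theorem mem_maxIdeal_smul_iff (x : X) : x ∈ maxIdeal K n • (⊤ : Submodule (E K n) X) ↔
    ∃ y : Fin n → X, ∑ j, (gen j : E K n) • y j = x := by
  constructor
  · intro hx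
    refine Submodule.smul_induction_on hx (fun a ha y _ => ?_) ?_
    · obtain ⟨b, hb⟩ := exists_sum_gen a
      rw [show aug a = 0 from ha, map_zero, zero_add] at hb
      refine ⟨fun j => b j • y, ?_⟩
      rw [hb, Finset.sum_smul]
      exact Finset.sum_congr rfl fun j _ => (mul_smul _ _ _).symm
    · rintro _ _ ⟨y, rfl⟩ ⟨z, rfl⟩
      exact ⟨y + z, by simp [smul_add, Finset.sum_add_distrib]⟩
  · rintro ⟨y, rfl⟩
    refine sum_mem fun j _ => Submodule.smul_mem_smul ?_ Submodule.mem_top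
    exact aug_gen j

variable [Module K X] [IsScalarTower K (E K n) X]

variable (K n X) in
/-- The operators by which the generators of `E` act on an `E`-module. -/
noncomputable def genOps (j : Fin n) : Module.End K X := Algebra.lsmul K K X (gen j : E K n)

theorem genOps_apply (j : Fin n) (x : X) : genOps K n X j x = (gen j : E K n) • x := rfl

theorem anticommute_genOps : Anticommute (genOps K n X) where
  sq i := by rw [genOps, ← map_mul, gen_mul_self, map_zero]
  swap i j := by rw [genOps, genOps, ← map_mul, gen_mul_gen, map_neg, map_mul]

theorem cartanD_genOps_zero (g : (Fin n →₀ ℕ) → X) :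
    cartanD (genOps K n X) g 0 = ∑ j, (gen j : E K n) • g (Finsupp.single j 1) := by
  simp only [cartanD_apply, zero_add, genOps_apply]

theorem mem_cartanZ_one (g : (Fin n →₀ ℕ) → X) (hg : g ∈ degFun K n X 1)
    (h : cartanD (genOps K n X) g 0 = 0) : g ∈ cartanZ (genOps K n X) 1 := by
  refine ⟨hg, funext fun α => ?_⟩
  by_cases hα : α = 0
  · rw [hα, h]
    rfl
  · exact cartanD_mem_degFun (i := 0) _ hg α (by rwa [Ne, Finsupp.degree_eq_zero_iff])

/-- The Cartan complex of a projective module is acyclic in positive degrees. -/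
theorem cartanZ_le_cartanB_of_projective [Module.Projective (E K n) X] (i : ℕ) (hi : 1 ≤ i) :
    cartanZ (genOps K n X) i ≤ cartanB (genOps K n X) i := by
  obtain ⟨s, hs⟩ := Module.projective_def'.1 (inferInstance : Module.Projective (E K n) X)
  intro f hf
  -- the contractions of a free module, restricted to its direct summand `X`
  refine mem_cartanB_of_contraction anticommute_genOps
    (fun j => ((Finsupp.linearCombination (E K n) id).toAddMonoidHom.comp
      (Finsupp.mapRange.addMonoidHom (contr j).toAddMonoidHom)).comp s.toAddMonoidHom)
    (fun j k x => ?_) hi hf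
  have h1 : Finsupp.linearCombination (E K n) id (s x) = x := LinearMap.congr_fun hs x
  change Finsupp.linearCombination (E K n) id
      (Finsupp.mapRange (contr j) (map_zero _) (s ((gen k : E K n) • x))) = _ -
    (gen k : E K n) • Finsupp.linearCombination (E K n) id
      (Finsupp.mapRange (contr j) (map_zero _) (s x))
  have h2 : Finsupp.mapRange (contr j) (map_zero _) (s ((gen k : E K n) • x)) =
      (if j = k then s x else 0) -
        (gen k : E K n) • Finsupp.mapRange (contr j) (map_zero _) (s x) := by
    ext y
    rw [map_smul, Finsupp.mapRange_apply, Finsupp.smul_apply, smul_eq_mul, contr_gen_mul]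
    split_ifs <;> simp
  rw [h2, map_sub, map_smul]
  split_ifs
  · rw [h1]
  · rw [map_zero]

/-- The first Cartan homology of a module, in terms of a presentation by a module with acyclic
Cartan complex. -/
theorem cartanDim_one_eq {P₀ P₁ P₂ : Type*} [AddCommGroup P₀] [Module (E K n) P₀] [Module K P₀]
    [IsScalarTower K (E K n) P₀] [AddCommGroup P₁] [Module (E K n) P₁] [Module K P₁]
    [IsScalarTower K (E K n) P₁] [AddCommGroup P₂] [Module (E K n) P₂]
    (d₂ : P₂ →ₗ[E K n] P₁) (d₁ : P₁ →ₗ[E K n] P₀) (π : P₀ →ₗ[E K n] X)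
    (h₁ : ∀ p, d₁ p = 0 ↔ p ∈ LinearMap.range d₂) (h₀ : ∀ p, π p = 0 ↔ p ∈ LinearMap.range d₁)
    (hπ : Function.Surjective π)
    (hac : cartanZ (genOps K n P₀) 1 ≤ cartanB (genOps K n P₀) 1) :
    cartanDim (genOps K n X) 1 = quotDim
      (((maxIdeal K n • (⊤ : Submodule (E K n) P₀)).comap d₁).restrictScalars K)
      ((LinearMap.range d₂ ⊔ maxIdeal K n • (⊤ : Submodule (E K n) P₁)).restrictScalars K) := by
  have hd : ∀ j p, d₁.restrictScalars K (genOps K n P₁ j p) =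
      genOps K n P₀ j (d₁.restrictScalars K p) := fun j p => map_smul d₁ _ _
  have hp : ∀ j p, π.restrictScalars K (genOps K n P₀ j p) =
      genOps K n X j (π.restrictScalars K p) := fun j p => map_smul π _ _
  -- pairs of `g` of degree `1` over `P₀` and `p ∈ P₁` with `∂g = d₁ p`
  let W : Submodule K (((Fin n →₀ ℕ) → P₀) × P₁) :=
    (degFun K n P₀ 1).prod ⊤ ⊓ LinearMap.eqLocus
      (LinearMap.proj 0 ∘ₗ cartanD (genOps K n P₀) ∘ₗ LinearMap.fst K _ _)
      (d₁.restrictScalars K ∘ₗ LinearMap.snd K _ _)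
  have hW : ∀ w : W, w.1.1 ∈ degFun K n P₀ 1 ∧ cartanD (genOps K n P₀) w.1.1 0 = d₁ w.1.2 :=
    fun w => ⟨w.2.1.1, w.2.2⟩
  have hWmk : ∀ g ∈ degFun K n P₀ 1, ∀ p, cartanD (genOps K n P₀) g 0 = d₁ p →
      ∃ w : W, w.1 = (g, p) := fun g hg p h => ⟨⟨(g, p), ⟨hg, trivial⟩, h⟩, rfl⟩
  refine quotDim_eq_quotDim _ _ _ _
    (cartanMap n (π.restrictScalars K) ∘ₗ LinearMap.fst K _ _ ∘ₗ W.subtype)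
    (LinearMap.snd K _ _ ∘ₗ W.subtype) (fun w => ?_) (fun f hf => ?_) (fun w => ?_)
    (fun p hp' => ?_) fun w => ?_
  · obtain ⟨h1, h2⟩ := hW w
    refine mem_cartanZ_one (cartanMap n (π.restrictScalars K) w.1.1)
      (cartanMap_mem_degFun _ h1) ?_
    rw [cartanD_cartanMap (e := genOps K n P₀) _ hp, cartanMap_apply, h2]
    exact (h₀ _).2 ⟨_, rfl⟩
  · obtain ⟨g, hg, rfl⟩ := exists_cartanMap_eq (π.restrictScalars K) hf.1 fun α => hπ (f α)
    have h0 : π (cartanD (genOps K n P₀) g 0) = 0 := by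
      have := congrFun (show cartanD _ _ = 0 from hf.2) 0
      rwa [cartanD_cartanMap (e := genOps K n P₀) _ hp] at this
    obtain ⟨p, hpg⟩ := (h₀ _).1 h0
    obtain ⟨w, hw⟩ := hWmk g hg p hpg.symm
    exact ⟨w, congrArg (fun x => cartanMap n (π.restrictScalars K) x.1) hw⟩
  · obtain ⟨h1, h2⟩ := hW w
    change d₁ w.1.2 ∈ maxIdeal K n • (⊤ : Submodule (E K n) P₀)
    rw [← h2, cartanD_genOps_zero, mem_maxIdeal_smul_iff]
    exact ⟨_, rfl⟩
  · obtain ⟨y, hy⟩ := (mem_maxIdeal_smul_iff (K := K) (n := n) _).1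
      (show d₁ p ∈ maxIdeal K n • (⊤ : Submodule (E K n) P₀) from hp')
    obtain ⟨g, hg, hgy⟩ := exists_degFun_one (K := K) y
    obtain ⟨w, hw⟩ := hWmk g hg p (by rw [cartanD_genOps_zero, ← hy]; simp only [hgy])
    exact ⟨w, congrArg Prod.snd hw⟩
  · obtain ⟨h1, h2⟩ := hW w
    change cartanMap n (π.restrictScalars K) w.1.1 ∈ cartanB _ 1 ↔
      w.1.2 ∈ LinearMap.range d₂ ⊔ maxIdeal K n • (⊤ : Submodule (E K n) P₁)
    constructor
    · rintro ⟨f, hf, hfw⟩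
      obtain ⟨g, hg, rfl⟩ := exists_cartanMap_eq (π.restrictScalars K) hf fun α => hπ (f α)
      rw [cartanD_cartanMap (e := genOps K n P₀) _ hp] at hfw
      have h0 : ∀ α, (w.1.1 - cartanD (genOps K n P₀) g) α ∈
          LinearMap.range (d₁.restrictScalars K) := by
        intro α
        refine (h₀ _).1 ?_
        rw [Pi.sub_apply, map_sub, sub_eq_zero]
        exact (congrFun hfw α).symm
      obtain ⟨q, hq, hqg⟩ := exists_cartanMap_eq (d₁.restrictScalars K)
        (sub_mem h1 (cartanD_mem_degFun _ hg)) h0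
      have h3 : d₁ (w.1.2 - cartanD (genOps K n P₁) q 0) = 0 := by
        have := congrFun (cartanD_cartanMap (e := genOps K n P₁) (e' := genOps K n P₀) _ hd q) 0
        rw [hqg, map_sub, cartanD_cartanD anticommute_genOps, sub_zero, h2] at this
        rw [map_sub, sub_eq_zero]
        exact this
      rw [h₁] at h3
      have h4 := Submodule.add_mem_sup h3 ((mem_maxIdeal_smul_iff (K := K) (n := n) _).2
        ⟨_, (cartanD_genOps_zero q).symm⟩)
      rwa [sub_add_cancel] at h4
    · intro h
      obtain ⟨p', hp', q', hq', hpq⟩ := Submodule.mem_sup.1 h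
      obtain ⟨y, hy⟩ := (mem_maxIdeal_smul_iff (K := K) (n := n) _).1 hq'
      obtain ⟨q, hq, hqy⟩ := exists_degFun_one (K := K) y
      have hz : w.1.1 - cartanMap n (d₁.restrictScalars K) q ∈ cartanZ (genOps K n P₀) 1 := by
        refine mem_cartanZ_one _ (sub_mem h1 (cartanMap_mem_degFun _ hq)) ?_
        rw [map_sub, cartanD_cartanMap (e := genOps K n P₁) _ hd, Pi.sub_apply, h2,
          cartanMap_apply, cartanD_genOps_zero]
        simp only [hqy]
        rw [hy, ← hpq]
        change d₁ (p' + q') - d₁ q' = 0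
        rw [map_add, (h₁ p').2 hp', zero_add, sub_self]
      obtain ⟨g, hg, hgw⟩ := hac hz
      refine ⟨cartanMap n (π.restrictScalars K) g, cartanMap_mem_degFun _ hg, ?_⟩
      rw [cartanD_cartanMap (e := genOps K n P₀) _ hp, hgw, map_sub, sub_eq_self]
      funext α
      exact (h₀ _).2 ⟨q α, rfl⟩

end ExteriorModules

/-! ### Betti numbers are dimensions of Cartan homology -/

section Betti

open CategoryTheory

theorem finrank_homology_eq_quotDim {K : Type u} [Field K] (S : ShortComplex (ModuleCat.{u} K)) :
    Module.finrank K S.homology =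
      quotDim (LinearMap.ker S.g.hom) (LinearMap.range S.f.hom) := by
  have h : LinearMap.range S.moduleCatToCycles =
      (LinearMap.range S.f.hom).submoduleOf (LinearMap.ker S.g.hom) := by
    ext ⟨x, hx⟩
    constructor
    · rintro ⟨y, hy⟩
      exact ⟨y, congrArg Subtype.val hy⟩
    · rintro ⟨y, hy⟩
      exact ⟨y, Subtype.ext hy⟩
  rw [quotDim, ← h]
  exact S.moduleCatHomologyIso.toLinearEquiv.finrank_eq

variable {K : Type u} [Field K] {n : ℕ}

/-- The vector space underlying an `E`-module, for the objects of the category of `E`-modules. -/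
noncomputable local instance (X : ModuleCat.{u} (E K n)) : Module K X := fieldModule K n X

local instance (X : ModuleCat.{u} (E K n)) : IsScalarTower K (E K n) X := ⟨fun c a x => by
  change (c • a) • x = algebraMap K (E K n) c • a • x
  rw [Algebra.smul_def, mul_smul]⟩

/-- The projection `X → X / 𝔪 X` as a `K`-linear map into the value of the functor `K ⊗_E -`. -/
noncomputable def toTensorField (X : ModuleCat.{u} (E K n)) :
    X →ₗ[K] (tensorField K n).obj X where
  toFun x := (maxIdeal K n • (⊤ : Submodule (E K n) X)).mkQ x
  map_add' _ _ := map_add _ _ _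
  map_smul' _ _ := rfl

theorem toTensorField_surjective (X : ModuleCat.{u} (E K n)) :
    Function.Surjective (toTensorField X) :=
  Submodule.mkQ_surjective (maxIdeal K n • (⊤ : Submodule (E K n) X))

theorem toTensorField_eq_zero_iff (X : ModuleCat.{u} (E K n)) (x : X) :
    toTensorField X x = 0 ↔ x ∈ maxIdeal K n • (⊤ : Submodule (E K n) X) :=
  Submodule.Quotient.mk_eq_zero _

theorem tensorField_map_toTensorField {X Y : ModuleCat.{u} (E K n)} (f : X ⟶ Y) (x : X) :
    ((tensorField K n).map f).hom (toTensorField X x) = toTensorField Y (f.hom x) :=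
  rfl

theorem finrank_homology_map_tensorField (S : ShortComplex (ModuleCat.{u} (E K n))) :
    Module.finrank K (S.map (tensorField K n)).homology = quotDim
      (((maxIdeal K n • (⊤ : Submodule (E K n) S.X₃)).comap S.g.hom).restrictScalars K)
      ((LinearMap.range S.f.hom ⊔ maxIdeal K n • (⊤ : Submodule (E K n) S.X₂)).restrictScalars K)
      := by
  rw [finrank_homology_eq_quotDim]
  have hZ : ∀ x : S.X₂, toTensorField S.X₂ x ∈
      LinearMap.ker (S.map (tensorField K n)).g.hom ↔
        S.g.hom x ∈ maxIdeal K n • (⊤ : Submodule (E K n) S.X₃) := fun x => by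
    rw [← toTensorField_eq_zero_iff, ← tensorField_map_toTensorField]
    rfl
  refine (quotDim_eq_quotDim _ _ _ _ (Submodule.subtype _) (toTensorField S.X₂ ∘ₗ Submodule.subtype
    (((maxIdeal K n • (⊤ : Submodule (E K n) S.X₃)).comap S.g.hom).restrictScalars K))
    (fun w => w.2) (fun z hz => ⟨⟨z, hz⟩, rfl⟩) (fun w => (hZ _).2 w.2) (fun z hz => ?_)
    fun w => ?_).symm
  · obtain ⟨x, rfl⟩ := toTensorField_surjective _ z
    exact ⟨⟨x, (hZ x).1 hz⟩, rfl⟩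
  · obtain ⟨w, hw⟩ := w
    change w ∈ LinearMap.range S.f.hom ⊔ maxIdeal K n • (⊤ : Submodule (E K n) S.X₂) ↔
      toTensorField S.X₂ w ∈ LinearMap.range ((tensorField K n).map S.f).hom
    constructor
    · intro h
      obtain ⟨_, ⟨x, rfl⟩, y, hy, rfl⟩ := Submodule.mem_sup.1 h
      refine ⟨toTensorField S.X₁ x, ?_⟩
      rw [tensorField_map_toTensorField, map_add, (toTensorField_eq_zero_iff _ y).2 hy, add_zero]
    · rintro ⟨x, hx⟩
      obtain ⟨x, rfl⟩ := toTensorField_surjective _ x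
      rw [tensorField_map_toTensorField, eq_comm, ← sub_eq_zero, ← map_sub,
        toTensorField_eq_zero_iff] at hx
      have := Submodule.add_mem_sup (LinearMap.mem_range_self S.f.hom x) hx
      rwa [add_sub_cancel] at this

/-- Positive Betti numbers as homology of a projective resolution tensored with `K`. -/
theorem betti_succ_eq_finrank_homology {M : ModuleCat.{u} (E K n)} (P : ProjectiveResolution M)
    (i : ℕ) : betti K n M (i + 1) = Module.finrank K
      ((ShortComplex.mk _ _ (P.complex.d_comp_d (i + 2) (i + 1) i)).map
        (tensorField K n)).homology := by
  refine (P.isoLeftDerivedObj (tensorField K n) (i + 1)).toLinearEquiv.finrank_eq.trans ?_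
  exact (HomologicalComplex.homologyIsoSc' (((tensorField K n).mapHomologicalComplex _).obj
    P.complex) (i + 2) (i + 1) i (by simp) (by simp)).toLinearEquiv.finrank_eq

theorem cartanDim_genOps_eq_of_surjective {P₀ P₁ X : Type*} [AddCommGroup P₀] [Module (E K n) P₀]
    [Module K P₀] [IsScalarTower K (E K n) P₀] [AddCommGroup P₁] [Module (E K n) P₁]
    [AddCommGroup X] [Module (E K n) X] [Module K X] [IsScalarTower K (E K n) X]
    (d₁ : P₁ →ₗ[E K n] P₀) (π : P₀ →ₗ[E K n] X) (hπ : Function.Surjective π)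
    (h₀ : ∀ p, π p = 0 ↔ p ∈ LinearMap.range d₁) (i : ℕ) :
    cartanDim (genOps K n X) i = cartanDim (genOps K n (P₀ ⧸ LinearMap.range d₁)) i := by
  let e : (P₀ ⧸ LinearMap.range d₁) ≃ₗ[E K n] X :=
    (Submodule.quotEquivOfEq _ _ (Submodule.ext fun p => (h₀ p).symm)).trans
      (π.quotKerEquivOfSurjective hπ)
  refine (cartanDim_eq_of_equiv (e.restrictScalars K) (fun l x => ?_) _).symm
  rw [genOps_apply, genOps_apply]
  exact map_smul e (gen l) x

/-- Dimension shifting for `0 → P₁ / im d₂ → P₀ → P₀ / im d₁ → 0`. -/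
theorem cartanDim_quotient_succ {P₀ P₁ P₂ : Type*} [AddCommGroup P₀] [Module (E K n) P₀]
    [Module K P₀] [IsScalarTower K (E K n) P₀] [AddCommGroup P₁] [Module (E K n) P₁] [Module K P₁]
    [IsScalarTower K (E K n) P₁] [AddCommGroup P₂] [Module (E K n) P₂]
    (d₂ : P₂ →ₗ[E K n] P₁) (d₁ : P₁ →ₗ[E K n] P₀)
    (h₁ : ∀ p, d₁ p = 0 ↔ p ∈ LinearMap.range d₂)
    (hac : ∀ i, 1 ≤ i → cartanZ (genOps K n P₀) i ≤ cartanB (genOps K n P₀) i)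
    {i : ℕ} (hi : 1 ≤ i) :
    cartanDim (genOps K n (P₀ ⧸ LinearMap.range d₁)) (i + 1) =
      cartanDim (genOps K n (P₁ ⧸ LinearMap.range d₂)) i := by
  let j : (P₁ ⧸ LinearMap.range d₂) →ₗ[E K n] P₀ :=
    (LinearMap.range d₂).liftQ d₁ fun p hp => (h₁ p).2 hp
  have hjl : ∀ l x, j.restrictScalars K (genOps K n (P₁ ⧸ LinearMap.range d₂) l x) =
      genOps K n P₀ l (j.restrictScalars K x) := by
    intro l x
    rw [genOps_apply, genOps_apply]
    exact map_smul j (gen l) x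
  have hql : ∀ l x, (LinearMap.range d₁).mkQ.restrictScalars K (genOps K n P₀ l x) =
      genOps K n (P₀ ⧸ LinearMap.range d₁) l ((LinearMap.range d₁).mkQ.restrictScalars K x) := by
    intro l x
    rw [genOps_apply, genOps_apply]
    exact map_smul (LinearMap.range d₁).mkQ (gen l) x
  have hji : Function.Injective (j.restrictScalars K) := by
    have hj : LinearMap.ker j = ⊥ :=
      Submodule.ker_liftQ_eq_bot _ _ _ fun p hp => (h₁ p).1 hp
    have hji : Function.Injective j := LinearMap.ker_eq_bot.1 hj
    exact hji
  have hqs : Function.Surjective ((LinearMap.range d₁).mkQ.restrictScalars K) := fun y => by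
    obtain ⟨x, rfl⟩ := Submodule.mkQ_surjective (LinearMap.range d₁) y
    exact ⟨x, rfl⟩
  refine cartanDim_succ_eq anticommute_genOps (j.restrictScalars K)
    ((LinearMap.range d₁).mkQ.restrictScalars K) hjl hql hji (fun x => ?_) hqs hac hi
  · have hj : LinearMap.range j = LinearMap.range d₁ := Submodule.range_liftQ _ _ _
    have h2 : x ∈ LinearMap.range (j.restrictScalars K) ↔ x ∈ LinearMap.range j := Iff.rfl
    rw [h2, hj]
    exact Submodule.Quotient.mk_eq_zero (LinearMap.range d₁)

/-- The `i + 1`-st Cartan homology of the `k`-th syzygy of `M`, by shifting down to the first Cartan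
homology of the `k + i`-th syzygy. -/
theorem cartanDim_quotient_range {M : ModuleCat.{u} (E K n)} (P : ProjectiveResolution M)
    (i k : ℕ) :
    cartanDim (genOps K n (P.complex.X k ⧸ LinearMap.range (P.complex.d (k + 1) k).hom)) (i + 1) =
      betti K n M (k + i + 1) := by
  have hd : ∀ k p, (P.complex.d (k + 1) k).hom p = 0 ↔
      p ∈ LinearMap.range (P.complex.d (k + 2) (k + 1)).hom := by
    intro k p
    constructor
    · exact (ShortComplex.moduleCat_exact_iff _).1 (P.exact_succ k) p
    · rintro ⟨q, rfl⟩
      exact ShortComplex.moduleCat_zero_apply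
        (ShortComplex.mk _ _ (P.complex.d_comp_d (k + 2) (k + 1) k)) q
  have hac : ∀ k i, 1 ≤ i → cartanZ (genOps K n (P.complex.X k)) i ≤
      cartanB (genOps K n (P.complex.X k)) i := by
    intro k i hi
    have : Module.Projective (E K n) (P.complex.X k) :=
      ModuleCat.projective_of_module_projective _
    exact cartanZ_le_cartanB_of_projective i hi
  induction i generalizing k with
  | zero =>
    rw [zero_add, add_zero, betti_succ_eq_finrank_homology P, finrank_homology_map_tensorField]
    have hs : ∀ p, (LinearMap.range (P.complex.d (k + 1) k).hom).mkQ p = 0 ↔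
        p ∈ LinearMap.range (P.complex.d (k + 1) k).hom :=
      fun p => Submodule.Quotient.mk_eq_zero _
    have hss := Submodule.mkQ_surjective (LinearMap.range (P.complex.d (k + 1) k).hom)
    exact cartanDim_one_eq (P.complex.d (k + 2) (k + 1)).hom (P.complex.d (k + 1) k).hom
      (LinearMap.range (P.complex.d (k + 1) k).hom).mkQ (hd k) hs hss (hac k 1 le_rfl)
  | succ i ih =>
    rw [show k + (i + 1) = k + 1 + i by ring, ← ih (k + 1)]
    exact cartanDim_quotient_succ (P.complex.d (k + 2) (k + 1)).hom (P.complex.d (k + 1) k).hom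
      (hd k) (hac k) (by omega)

/-- The positive Betti numbers are the dimensions of the Cartan homology. -/
theorem betti_succ_eq_cartanDim_moduleCat (M : ModuleCat.{u} (E K n)) (i : ℕ) :
    betti K n M (i + 1) = cartanDim (genOps K n M) (i + 1) := by
  obtain ⟨P⟩ : Nonempty (ProjectiveResolution M) := HasProjectiveResolution.out
  rw [show betti K n M (i + 1) = betti K n M (0 + i + 1) by rw [zero_add],
    ← cartanDim_quotient_range P]
  let π : P.complex.X 0 →ₗ[E K n] M := (P.π.f 0).hom
  have hπ : Function.Surjective π :=
    (ModuleCat.epi_iff_surjective (P.π.f 0)).1 inferInstance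
  have hex := ShortComplex.exact_of_g_is_cokernel
    (ShortComplex.mk _ _ P.complex_d_comp_π_f_zero) P.isColimitCokernelCofork
  have h₀ : ∀ x, π x = 0 ↔ x ∈ LinearMap.range (P.complex.d 1 0).hom := by
    refine fun x => ⟨fun hx => (ShortComplex.moduleCat_exact_iff _).1 hex x hx, ?_⟩
    rintro ⟨y, rfl⟩
    exact ShortComplex.moduleCat_zero_apply
      (ShortComplex.mk _ _ P.complex_d_comp_π_f_zero) y
  exact (cartanDim_genOps_eq_of_surjective _ π hπ h₀ (i + 1)).symm

end Betti

/-! ### Cartan homology and matrices of linear forms -/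

section Adjoint

variable {K : Type*} [Field K] {L₀ L₁ V₀ V₁ : Type*} [AddCommGroup L₀] [Module K L₀]
  [AddCommGroup L₁] [Module K L₁] [AddCommGroup V₀] [Module K V₀] [AddCommGroup V₁] [Module K V₁]

/-- Adjoint linear maps have the same rank. -/
theorem finrank_range_eq_of_adjoint [Module.Finite K V₀] [Module.Finite K V₁]
    (φ₀ : L₀ ≃ₗ[K] Module.Dual K V₀)
    (φ₁ : L₁ ≃ₗ[K] Module.Dual K V₁) (D : L₁ →ₗ[K] L₀) (d : V₀ →ₗ[K] V₁)
    (h : ∀ x v, φ₀ (D x) v = φ₁ x (d v)) :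
    Module.finrank K (LinearMap.range D) = Module.finrank K (LinearMap.range d) := by
  have h1 : φ₀.toLinearMap ∘ₗ D = d.dualMap ∘ₗ φ₁.toLinearMap :=
    LinearMap.ext fun x => LinearMap.ext fun v => h x v
  rw [← LinearMap.finrank_range_dualMap_eq_finrank_range d,
    ← LinearMap.range_comp_of_range_eq_top d.dualMap φ₁.range, ← h1, LinearMap.range_comp]
  exact (φ₀.finrank_map_eq _).symm

theorem finrank_map_eq_finrank_range_restrict {D : L₁ →ₗ[K] L₀} {p : Submodule K L₁}
    {q : Submodule K L₀} (h : ∀ x ∈ p, D x ∈ q) :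
    Module.finrank K (p.map D) = Module.finrank K (LinearMap.range (D.restrict h)) := by
  have : p.map D = (LinearMap.range (D.restrict h)).map q.subtype := by
    ext y
    constructor
    · rintro ⟨x, hx, rfl⟩
      exact ⟨_, ⟨⟨x, hx⟩, rfl⟩, rfl⟩
    · rintro ⟨_, ⟨⟨x, hx⟩, rfl⟩, rfl⟩
      exact ⟨x, hx, rfl⟩
  rw [this]
  exact (Submodule.equivMapOfInjective _ q.injective_subtype _).finrank_eq.symm

theorem finrank_inf_ker_add_finrank_map (D : L₁ →ₗ[K] L₀) (p : Submodule K L₁)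
    [Module.Finite K p] :
    Module.finrank K (p.map D) + Module.finrank K (p ⊓ LinearMap.ker D : Submodule K L₁) =
      Module.finrank K p := by
  have h := (D.domRestrict p).finrank_range_add_finrank_ker
  rw [LinearMap.range_domRestrict, LinearMap.ker_domRestrict] at h
  rw [← h, ← Submodule.map_comap_subtype]
  congr 1
  exact (Submodule.equivMapOfInjective _ p.injective_subtype _).finrank_eq.symm

theorem quotDim_eq_sub (Z B : Submodule K L₀) (h : B ≤ Z) [Module.Finite K Z] :
    quotDim Z B = Module.finrank K Z - Module.finrank K B := by
  have h1 := Submodule.finrank_quotient_add_finrank (B.submoduleOf Z)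
  have h2 := (Submodule.submoduleOfEquivOfLe h).finrank_eq
  rw [quotDim]
  omega

end Adjoint

section Pairing

open MvPolynomial

variable {K : Type*} [Field K] {n : ℕ} {X : Type*} [AddCommGroup X] [Module K X]
  {r : Type*}

/-- The matrix `∑_j x_j a_j` of linear forms. -/
noncomputable def linMat (a : Fin n → Matrix r r K) : Matrix r r (MvPolynomial (Fin n) K) :=
  Matrix.of fun p q => ∑ j, a j p q • (MvPolynomial.X j : MvPolynomial (Fin n) K)

/-- The vectors of polynomials that are homogeneous of degree `i`. -/
noncomputable abbrev homVec (K : Type*) [Field K] (n : ℕ) (r : Type*) (i : ℕ) :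
    Submodule K (r → MvPolynomial (Fin n) K) :=
  Submodule.pi Set.univ fun _ => homogeneousSubmodule (Fin n) K i

/-- The basis of the vectors of polynomials consisting of the monomials. -/
noncomputable def monBasis (K : Type*) [Field K] (n : ℕ) (r : Type*) [Fintype r]
    [DecidableEq r] : Module.Basis (Σ _ : r, (Fin n →₀ ℕ)) K (r → MvPolynomial (Fin n) K) :=
  Pi.basis fun _ => basisMonomials (Fin n) K

theorem monBasis_apply [Fintype r] [DecidableEq r] (q : r) (α : Fin n →₀ ℕ) :
    monBasis K n r ⟨q, α⟩ = Pi.single q (monomial α 1) := by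
  rw [monBasis, Pi.basis_apply, coe_basisMonomials]

theorem homogeneousComponent_comp_mem (i : ℕ) (h : r → MvPolynomial (Fin n) K) :
    (fun q => homogeneousComponent i (h q)) ∈ homVec K n r i :=
  fun q _ => homogeneousComponent_isHomogeneous i (h q)

theorem single_monomial_mem_homVec [DecidableEq r] {i : ℕ} (q : r) {α : Fin n →₀ ℕ}
    (hα : α.degree = i) :
    (Pi.single q (monomial α 1) : r → MvPolynomial (Fin n) K) ∈ homVec K n r i := by
  intro p _
  by_cases hp : p = q
  · subst hp
    rw [Pi.single_eq_same]
    exact isHomogeneous_monomial _ hα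
  · rw [Pi.single_eq_of_ne hp]
    exact zero_mem _

theorem isHomogeneous_linMat (a : Fin n → Matrix r r K) (p q : r) :
    (linMat a p q).IsHomogeneous 1 := by
  rw [linMat, Matrix.of_apply]
  exact sum_mem (S := homogeneousSubmodule (Fin n) K 1) fun j _ =>
    Submodule.smul_mem _ _ (isHomogeneous_X K j)

theorem mulVecK_mem_homVec [Fintype r] {A : Matrix r r (MvPolynomial (Fin n) K)}
    (hA : ∀ p q, (A p q).IsHomogeneous 1) {i : ℕ} {h : r → MvPolynomial (Fin n) K}
    (hh : h ∈ homVec K n r i) : mulVecK A h ∈ homVec K n r (i + 1) := by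
  intro p _
  refine sum_mem fun q _ => ?_
  rw [add_comm]
  exact (hA p q).mul (hh q trivial)

variable [Fintype r] [DecidableEq r] (b : Module.Basis r K X)

/-- The pairing `⟨f, h⟩ = ∑_{α, q} f(α)_q h_{q, α}` of a function `f` with values in a space with
basis and a vector of polynomials. -/
noncomputable def polyPairing :
    ((Fin n →₀ ℕ) → X) →ₗ[K] Module.Dual K (r → MvPolynomial (Fin n) K) where
  toFun f := (monBasis K n r).constr K fun x => b.repr (f x.2) x.1
  map_add' f g := by
    rw [← map_add]
    congr 1
    funext x
    simp
  map_smul' c f := by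
    rw [← map_smul]
    congr 1
    funext x
    simp

theorem polyPairing_single (f : (Fin n →₀ ℕ) → X) (q : r) (α : Fin n →₀ ℕ) :
    polyPairing b f (Pi.single q (monomial α 1)) = b.repr (f α) q := by
  rw [← monBasis_apply]
  exact (monBasis K n r).constr_basis K _ _

/-- The differential of the Cartan complex is adjoint to multiplication by the transpose of the
matrix of linear forms. -/
theorem polyPairing_cartanD (e : Fin n → Module.End K X) (f : (Fin n →₀ ℕ) → X)
    (h : r → MvPolynomial (Fin n) K) : polyPairing b (cartanD e f) h =
      polyPairing b f (mulVecK (linMat fun j => LinearMap.toMatrix b b (e j)).transpose h) := by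
  suffices H : polyPairing b (cartanD e f) = polyPairing b f ∘ₗ
      mulVecK (linMat fun j => LinearMap.toMatrix b b (e j)).transpose from LinearMap.congr_fun H h
  refine (monBasis K n r).ext fun ⟨q, α⟩ => ?_
  have key : mulVecK (linMat fun j => LinearMap.toMatrix b b (e j)).transpose
      (Pi.single q (monomial α 1)) = ∑ j, ∑ p, LinearMap.toMatrix b b (e j) q p •
        (Pi.single p (monomial (α + Finsupp.single j 1) 1) : r → MvPolynomial (Fin n) K) := by
    funext p
    have h1 : mulVecK (linMat fun j => LinearMap.toMatrix b b (e j)).transpose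
      (Pi.single q (monomial α 1)) p =
        (linMat fun j => LinearMap.toMatrix b b (e j)) q p * monomial α 1 :=
      congrFun (Matrix.mulVec_single _ _ _) p
    rw [h1, linMat, Matrix.of_apply, Finset.sum_mul, Finset.sum_apply]
    refine Finset.sum_congr rfl fun j _ => ?_
    rw [Finset.sum_apply, Finset.sum_eq_single p]
    · rw [Pi.smul_apply, Pi.single_eq_same, smul_mul_assoc, MvPolynomial.X, monomial_mul,
        add_comm, one_mul]
    · intro p' _ hp'
      rw [Pi.smul_apply, Pi.single_eq_of_ne hp'.symm, smul_zero]
    · exact fun hp => (hp (Finset.mem_univ p)).elim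
  rw [monBasis_apply, LinearMap.comp_apply, key, polyPairing_single, map_sum, cartanD_apply,
    map_sum, Finsupp.finsetSum_apply]
  refine Finset.sum_congr rfl fun j _ => ?_
  rw [map_sum, ← LinearMap.toMatrix_mulVec_repr b b]
  refine Finset.sum_congr rfl fun p _ => ?_
  rw [map_smul, polyPairing_single, smul_eq_mul]

/-- In each degree, the pairing is perfect. -/
noncomputable def degFunEquivDual (i : ℕ) :
    degFun K n X i ≃ₗ[K] Module.Dual K (homVec K n r i) :=
  LinearEquiv.ofBijective
    ((homVec K n r i).subtype.dualMap ∘ₗ polyPairing b ∘ₗ (degFun K n X i).subtype) <| by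
    constructor
    · rw [injective_iff_map_eq_zero]
      rintro ⟨f, hf⟩ h0
      refine Subtype.ext (funext fun α => ?_)
      by_cases hα : α.degree = i
      · refine b.repr.injective (Finsupp.ext fun q => ?_)
        rw [← polyPairing_single]
        refine (LinearMap.congr_fun h0 ⟨_, single_monomial_mem_homVec q hα⟩).trans ?_
        simp
      · exact hf α hα
    · intro l
      -- extend a functional by zero to the other degrees, and read off `f` from its values on
      -- the monomials
      let pr : (r → MvPolynomial (Fin n) K) →ₗ[K] homVec K n r i :=
        LinearMap.codRestrict _ ((homogeneousComponent i).compLeft r)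
          fun h => homogeneousComponent_comp_mem i h
      refine ⟨⟨fun α => ∑ q, l (pr (Pi.single q (monomial α 1))) • b q, fun α hα => ?_⟩, ?_⟩
      · refine Finset.sum_eq_zero fun q _ => ?_
        have : pr (Pi.single q (monomial α 1)) = 0 := by
          refine Subtype.ext (funext fun p => ?_)
          change homogeneousComponent i ((Pi.single q (monomial α 1) : r → _) p) = 0
          by_cases hp : p = q
          · subst hp
            rw [Pi.single_eq_same, homogeneousComponent_of_mem (isHomogeneous_monomial _ rfl),
              if_neg (Ne.symm hα)]
          · rw [Pi.single_eq_of_ne hp, map_zero]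
        rw [this, map_zero, zero_smul]
      · have key : polyPairing b (fun α => ∑ q, l (pr (Pi.single q (monomial α 1))) • b q) =
            l ∘ₗ pr := by
          refine (monBasis K n r).ext fun ⟨q, α⟩ => ?_
          rw [monBasis_apply, polyPairing_single, LinearMap.comp_apply, b.repr_sum_self]
        refine LinearMap.ext fun ⟨h, hh⟩ => ?_
        refine (LinearMap.congr_fun key h).trans (congrArg l (Subtype.ext (funext fun q => ?_)))
        exact homogeneousComponent_of_mem (hh q trivial) |>.trans (if_pos rfl)

theorem degFunEquivDual_apply (i : ℕ) (f : degFun K n X i) (h : homVec K n r i) :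
    degFunEquivDual b i f h = polyPairing b (f : (Fin n →₀ ℕ) → X) (h : r → _) := rfl

instance (i : ℕ) : Module.Finite K (homVec K n r i) :=
  finite_pi_submodule _

theorem finite_degFun (b : Module.Basis r K X) (i : ℕ) : Module.Finite K (degFun K n X i) :=
  Module.Finite.equiv (degFunEquivDual b i).symm

theorem finrank_map_cartanD (e : Fin n → Module.End K X) (i : ℕ) :
    Module.finrank K ((degFun K n X (i + 1)).map (cartanD e)) = Module.finrank K
      ((homVec K n r i).map
        (mulVecK (linMat fun j => LinearMap.toMatrix b b (e j)).transpose)) := by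
  have hA : ∀ h ∈ homVec K n r i, mulVecK (linMat fun j => LinearMap.toMatrix b b (e j)).transpose
      h ∈ homVec K n r (i + 1) := fun h hh =>
    mulVecK_mem_homVec (fun p q => isHomogeneous_linMat _ q p) hh
  rw [finrank_map_eq_finrank_range_restrict fun f hf => cartanD_mem_degFun e hf,
    finrank_map_eq_finrank_range_restrict hA]
  refine finrank_range_eq_of_adjoint (degFunEquivDual b i) (degFunEquivDual b (i + 1)) _ _
    fun f h => ?_
  rw [degFunEquivDual_apply, degFunEquivDual_apply]
  exact polyPairing_cartanD b e f h

/-- Both dimensions are those of the degree `i + 1` part minus the ranks of the two neighbouring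
differentials, which are adjoint to each other in the opposite order. -/
theorem cartanDim_eq_matCohDim {e : Fin n → Module.End K X} (he : Anticommute e) (i : ℕ) :
    cartanDim e (i + 1) =
      matCohDim (linMat fun j => LinearMap.toMatrix b b (e j)).transpose (i + 1) := by
  have := finite_degFun (n := n) b (i + 1)
  have h1 := finrank_inf_ker_add_finrank_map (cartanD e) (degFun K n X (i + 1))
  have h2 := finrank_inf_ker_add_finrank_map
    (mulVecK (linMat fun j => LinearMap.toMatrix b b (e j)).transpose) (homVec K n r (i + 1))
  have h3 : Module.finrank K (degFun K n X (i + 1)) = Module.finrank K (homVec K n r (i + 1)) :=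
    (degFunEquivDual b (i + 1)).finrank_eq.trans Subspace.dual_finrank_eq
  have h4 := finrank_map_cartanD b e i
  have h5 := finrank_map_cartanD b e (i + 1)
  have : Module.Finite K (cartanZ e (i + 1)) := Submodule.finiteDimensional_of_le inf_le_left
  rw [cartanDim, quotDim_eq_sub _ _ (cartanB_le_cartanZ he (i + 1)), cartanZ, cartanB, matCohDim,
    cocyc, cobd]
  change _ = Module.finrank K (homVec K n r (i + 1) ⊓ LinearMap.ker (mulVecK _) :
    Submodule K _) - Module.finrank K ((homVec K n r i).map (mulVecK _))
  omega

theorem linMat_mul_self {e : Fin n → Module.End K X} (he : Anticommute e) :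
    (linMat fun j => LinearMap.toMatrix b b (e j)) *
      (linMat fun j => LinearMap.toMatrix b b (e j)) = 0 := by
  ext1 p q
  rw [Matrix.mul_apply]
  have h : ∀ i j, ∑ l, LinearMap.toMatrix b b (e i) p l * LinearMap.toMatrix b b (e j) l q =
      LinearMap.toMatrix b b (e i * e j) p q := fun i j => by
    rw [LinearMap.toMatrix_mul, Matrix.mul_apply]
  have h' : ∀ l, linMat (fun j => LinearMap.toMatrix b b (e j)) p l *
      linMat (fun j => LinearMap.toMatrix b b (e j)) l q = ∑ x : Fin n × Fin n,
        (LinearMap.toMatrix b b (e x.1) p l * LinearMap.toMatrix b b (e x.2) l q) •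
          (MvPolynomial.X x.1 * MvPolynomial.X x.2 : MvPolynomial (Fin n) K) := by
    intro l
    rw [linMat, Matrix.of_apply, Matrix.of_apply, Finset.sum_mul_sum, ← Finset.sum_product']
    refine Finset.sum_congr rfl fun x _ => ?_
    rw [smul_mul_smul_comm]
  simp only [h']
  rw [Finset.sum_comm]
  simp only [← Finset.sum_smul, h]
  -- the terms of `(j, k)` and `(k, j)` cancel, and those of `(j, j)` vanish
  refine Finset.sum_involution (fun x _ => x.swap) ?_ ?_ (fun x _ => Finset.mem_univ _)
    fun x _ => Prod.swap_swap x
  · rintro ⟨j, k⟩ _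
    simp only [Prod.swap_prod_mk]
    rw [he.swap j k, map_neg, Matrix.neg_apply, mul_comm (MvPolynomial.X k), neg_smul,
      neg_add_cancel]
  · rintro ⟨j, k⟩ _ h0 h'
    have : k = j := congrArg Prod.fst h'
    subst this
    refine h0 ?_
    dsimp only
    rw [he.sq, map_zero, Matrix.zero_apply, zero_smul]

end Pairing

/-! ### Comparison of the Betti numbers of a module and its dual -/

section Graded

variable {K : Type u} [Field K] {n : ℕ}

theorem GrMod.exists_homogeneous_basis (M : GrMod K n) :
    ∃ (r : Type u) (_ : Fintype r) (b : Module.Basis r K M.carrier) (ht : r → ℤ),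
      (∀ l, b l ∈ M.piece (ht l)) ∧
        ∀ (d : ℤ) (x : M.carrier), x ∈ M.piece d → ∀ l, b.repr x l ≠ 0 → ht l = d := by
  let P : ℤ → Submodule K M.carrier := fun d =>
    { M.piece d with
      smul_mem' := fun c x hx => by
        have h0 : algebraMap K (E K n) c ∈ ⋀[K]^0 (Fin n → K) := by
          rw [ExteriorAlgebra.exteriorPower, pow_zero]
          exact Submodule.algebraMap_mem c
        have := M.smul_mem 0 d _ x h0 hx
        rwa [Nat.cast_zero, zero_add] at this }
  have hP : DirectSum.IsInternal P := M.internal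
  let b := hP.collectedBasis fun d => Module.Basis.ofVectorSpace K (P d)
  have : Finite (Σ d, Module.Basis.ofVectorSpaceIndex K (P d)) := Module.Finite.finite_basis b
  refine ⟨_, Fintype.ofFinite _, b, fun l => l.1, fun l => ?_, fun d x hx ⟨d', l⟩ hl => ?_⟩
  · exact hP.collectedBasis_mem _ l
  · by_contra hne
    exact hl (hP.collectedBasis_repr_of_mem_ne _ (Ne.symm hne) hx)

theorem betti_succ_eq_cartanDim (M : GrMod K n) (i : ℕ) :
    betti K n M.carrier (i + 1) = cartanDim (genOps K n M.carrier) (i + 1) :=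
  betti_succ_eq_cartanDim_moduleCat (ModuleCat.of (E K n) M.carrier) i

theorem transpose_linMat {r : Type*} (a : Fin n → Matrix r r K) :
    (linMat a).transpose = linMat fun j => (a j).transpose := rfl

/-- The Betti numbers of `M` and of `M^*` are the cohomology of the transpose `Aᵀ` and of `A`, for a
matrix `A` of linear forms that describes the action of `E` in a homogeneous basis of `M`. The dual
basis yields the transposed matrix. The entry `A m l` is nonzero only if the degree `ht m` of the
`m`-th basis vector is one more than `ht l`; only the inequality is recorded. -/
theorem exists_matCohDim (M : GrMod K n) : ∃ (r : Type u) (_ : Fintype r) (_ : DecidableEq r)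
    (A : Matrix r r (MvPolynomial (Fin n) K)) (ht : r → ℤ),
    (∀ p q, (A p q).IsHomogeneous 1) ∧ A * A = 0 ∧ (∀ m l, A m l ≠ 0 → ht l < ht m) ∧
    (∀ i, betti K n M.carrier (i + 1) = matCohDim A.transpose (i + 1)) ∧
    ∀ i, betti K n M.dual.carrier (i + 1) = matCohDim A (i + 1) := by
  classical
  obtain ⟨r, _, b, ht, hb, hrepr⟩ := M.exists_homogeneous_basis
  refine ⟨r, inferInstance, inferInstance,
    linMat fun j => LinearMap.toMatrix b b (genOps K n M.carrier j), ht,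
    isHomogeneous_linMat _, linMat_mul_self b anticommute_genOps, fun m l hml => ?_, fun i => ?_,
    fun i => ?_⟩
  · by_contra hlt
    refine hml ?_
    rw [linMat, Matrix.of_apply]
    refine Finset.sum_eq_zero fun j _ => ?_
    rw [LinearMap.toMatrix_apply, genOps_apply]
    have h1 := M.smul_mem 1 (ht l) (gen j) (b l) (gen_mem j) (hb l)
    have h2 : b.repr ((gen j : E K n) • b l) m = 0 := by
      by_contra h
      have := hrepr _ _ h1 m h
      omega
    rw [h2, zero_smul]
  · rw [betti_succ_eq_cartanDim, cartanDim_eq_matCohDim b anticommute_genOps]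
  · let b' : Module.Basis r K M.dual.carrier := b.dualBasis.map (dualEquiv M).symm
    have h : ∀ j, LinearMap.toMatrix b' b' (genOps K n M.dual.carrier j) =
        (LinearMap.toMatrix b b (genOps K n M.carrier j)).transpose := by
      intro j
      ext p q
      rw [Matrix.transpose_apply, LinearMap.toMatrix_apply, LinearMap.toMatrix_apply]
      have h1 : ∀ x : M.dual.carrier, b'.repr x p = dualEquiv M x (b p) := fun x => by
        rw [Module.Basis.map_repr]
        simp
      rw [h1, genOps_apply, dualEquiv_smul M _ (gen_mem j), genOps_apply]
      simp [b']
    rw [betti_succ_eq_cartanDim, cartanDim_eq_matCohDim b' anticommute_genOps, transpose_linMat]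
    simp only [h, Matrix.transpose_transpose]

end Graded

section Growth

/-- A bound of the form `α i^(c-1)` on the values of `m` at `i ≥ 1` passes to a sequence that is
bounded by a sum of shifts of a multiple of `m`. -/
theorem le_mul_zpow_sub_one_of_le_sum {b m : ℕ → ℕ} {C N : ℕ} {a : Fin N → ℕ}
    (h : ∀ i, 1 ≤ i → b i ≤ ∑ k, if a k ≤ i then C * m (i - a k) else 0) {c : ℕ} {α : ℝ}
    (hm : ∀ i, 1 ≤ i → (m i : ℝ) ≤ α * (i : ℝ) ^ ((c : ℤ) - 1)) :
    ∃ β : ℝ, ∀ i : ℕ, 1 ≤ i → (b i : ℝ) ≤ β * (i : ℝ) ^ ((c : ℤ) - 1) := by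
  have hz : ∀ i : ℕ, 1 ≤ i → (i : ℝ) ^ ((c : ℤ) - 1) = (i : ℝ) ^ c / i := fun i hi => by
    rw [zpow_sub_one₀ (by positivity), zpow_natCast, div_eq_mul_inv]
  -- the summand `|α|` serves for `i > a'`, since then `i ≤ (1 + a') (i - a')`, and the summand
  -- `m 0` for `i = a'`
  have key : ∀ a' i : ℕ, 1 ≤ i → a' ≤ i →
      (m (i - a') : ℝ) ≤ (|α| + m 0) * (1 + a') * (i : ℝ) ^ ((c : ℤ) - 1) := by
    intro a' i hi hai
    have hi' : (1 : ℝ) ≤ i := by exact_mod_cast hi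
    have hpow : (1 : ℝ) ≤ (i : ℝ) ^ c := one_le_pow₀ hi'
    rw [hz i hi]
    obtain ⟨j, rfl⟩ := Nat.exists_eq_add_of_le hai
    rw [Nat.add_sub_cancel_left]
    obtain rfl | hj := Nat.eq_zero_or_pos j
    · have h1 : (1 : ℝ) ≤ (1 + a') * (((a' + 0 : ℕ) : ℝ) ^ c / (a' + 0 : ℕ)) := by
        rw [mul_div_assoc', le_div_iff₀ (by linarith)]
        push_cast at *
        nlinarith
      have h2 : (m 0 : ℝ) ≤ |α| + m 0 := by linarith [abs_nonneg α]
      have h3 : (0 : ℝ) ≤ m 0 := Nat.cast_nonneg _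
      rw [mul_assoc]
      exact h2.trans (le_mul_of_one_le_right (h3.trans h2) h1)
    · have hj' : (1 : ℝ) ≤ j := by exact_mod_cast hj
      have ha : (0 : ℝ) ≤ a' := Nat.cast_nonneg _
      have h1 : (j : ℝ) ^ c / j ≤ (1 + a') * (((a' + j : ℕ) : ℝ) ^ c / (a' + j : ℕ)) := by
        have h4 : (j : ℝ) ^ c ≤ ((a' + j : ℕ) : ℝ) ^ c :=
          pow_le_pow_left₀ (by linarith) (by push_cast; linarith) c
        rw [mul_div_assoc', div_le_div_iff₀ (by linarith) (by linarith)]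
        have h5 : ((a' + j : ℕ) : ℝ) ≤ (1 + a') * j := by push_cast; nlinarith
        calc (j : ℝ) ^ c * ((a' + j : ℕ) : ℝ)
            ≤ ((a' + j : ℕ) : ℝ) ^ c * ((1 + a') * j) :=
              mul_le_mul h4 h5 (by linarith) (by linarith)
          _ = (1 + a') * ((a' + j : ℕ) : ℝ) ^ c * j := by ring
      have h2 : (m j : ℝ) ≤ (|α| + m 0) * ((j : ℝ) ^ c / j) := by
        refine (hm j hj).trans ?_
        rw [hz j hj]
        refine mul_le_mul_of_nonneg_right ?_ (by positivity)
        linarith [le_abs_self α, (Nat.cast_nonneg (m 0) : (0 : ℝ) ≤ m 0)]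
      rw [mul_assoc]
      exact h2.trans (mul_le_mul_of_nonneg_left h1 (by positivity))
  refine ⟨∑ k, C * ((|α| + m 0) * (1 + a k)), fun i hi => ?_⟩
  have h1 : (b i : ℝ) ≤ ((∑ k, if a k ≤ i then C * m (i - a k) else 0 : ℕ) : ℝ) := by
    exact_mod_cast h i hi
  refine h1.trans ?_
  rw [Nat.cast_sum, Finset.sum_mul]
  refine Finset.sum_le_sum fun k _ => ?_
  split_ifs with hk
  · rw [Nat.cast_mul, mul_assoc]
    exact mul_le_mul_of_nonneg_left (key _ _ hi hk) (Nat.cast_nonneg _)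
  · rw [Nat.cast_zero]
    positivity

variable {K : Type u} [Field K] {n : ℕ}

theorem exists_betti_le_iff (M : GrMod K n) (c : ℕ) :
    (∃ α : ℝ, ∀ i : ℕ, 1 ≤ i → (betti K n M.carrier i : ℝ) ≤ α * (i : ℝ) ^ ((c : ℤ) - 1)) ↔
      ∃ α : ℝ, ∀ i : ℕ, 1 ≤ i →
        (betti K n M.dual.carrier i : ℝ) ≤ α * (i : ℝ) ^ ((c : ℤ) - 1) := by
  obtain ⟨r, _, _, A, ht, hA, hA2, hht, h1, h2⟩ := exists_matCohDim M
  have h1' : ∀ i, 1 ≤ i → betti K n M.carrier i = matCohDim A.transpose i := by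
    rintro (_ | i) hi
    · omega
    · exact h1 i
  have h2' : ∀ i, 1 ≤ i → betti K n M.dual.carrier i = matCohDim A i := by
    rintro (_ | i) hi
    · omega
    · exact h2 i
  constructor
  · rintro ⟨α, hα⟩
    -- the transpose of `A` raises degrees for the opposite grading
    obtain ⟨N, a, h⟩ := exists_matCohDim_transpose_le (A := A.transpose) (fun p q => hA q p)
      (by rw [← Matrix.transpose_mul, hA2, Matrix.transpose_zero]) (fun l => - ht l)
      (fun m l hml => neg_lt_neg (hht l m hml))
    refine le_mul_zpow_sub_one_of_le_sum (m := matCohDim A.transpose)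
      (fun i hi => (h2' i hi).le.trans (h i)) (c := c) (α := α) fun i hi => ?_
    rw [← h1' i hi]
    exact hα i hi
  · rintro ⟨α, hα⟩
    obtain ⟨N, a, h⟩ := exists_matCohDim_transpose_le hA hA2 ht hht
    refine le_mul_zpow_sub_one_of_le_sum (m := matCohDim A)
      (fun i hi => (h1' i hi).le.trans (h i)) (c := c) (α := α) fun i hi => ?_
    rw [← h2' i hi]
    exact hα i hi

theorem cx_dual (M : GrMod K n) : cx K n M.carrier = cx K n M.dual.carrier := by
  simp only [cx, Set.mem_ofPred_eq, exists_betti_le_iff M]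

theorem depth_dual (M : GrMod K n) : depth K n M.carrier = depth K n M.dual.carrier := by
  simp only [depth, Set.mem_ofPred_eq, isRegularSeq_dual_iff _ M]

end Growth

end ExtAlg

theorem mainTheorem6 (K : Type u) [Field K] (n : ℕ) (M : ExtAlg.GrMod K n)
    (hM : Nontrivial M.carrier) :
    (∀ (s : ℕ) (v : Fin s → ⋀[K]^1 (Fin n → K)),
      ExtAlg.IsRegularSeq M.carrier v ↔ ExtAlg.IsRegularSeq M.dual.carrier v) ∧
    ExtAlg.depth K n M.carrier = ExtAlg.depth K n M.dual.carrier ∧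
    ExtAlg.cx K n M.carrier = ExtAlg.cx K n M.dual.carrier :=
  ⟨fun _ v => ExtAlg.isRegularSeq_dual_iff v M, ExtAlg.depth_dual M, ExtAlg.cx_dual M⟩
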